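/- **Setting.** Let $D\ge 1$, $\pi_1\in(0,1)$, $\pi_0=1-\pi_1$, $L>0$, $x\in\mathbb R^D$, $\tau_x>0$, $\varepsilon_0>0$, $\alpha\in(0,1)$ and $\beta\in(0,1-\alpha)$ be fixed. For probability densities $f_0,f_1$ on $\mathbb R^D$ with respect to a common dominating measure, let $P_0,P_1$ be the corresponding distributions, $S=\{y: f_0(y)+f_1(y)>0\}$, and $m(y)=\pi_1f_1(y)/\{\pi_0f_0(y)+\pi_1f_1(y)\}$ for $y\in S$. Let $\mathbb P_{f_0,f_1}$ be the law of $n$ i.i.d. pairs $(X_i,Y_i)\in\mathbb R^D\times\{0,1\}$ from $\pi_1[P_1\times\delta_1]+\pi_0[P_0\times\delta_0]$. Let $\mathcal M_0$ be the class of $(f_0,f_1)$ with $m\equiv\pi_1$ on $S$. For $\delta\ge 0$ let $\mathcal M_{Lip}(\delta)$ be the class of $(f_0,f_1)$ such that $x\in S$, $|m(y)-m(z)|\le L\|y-z\|_2$ for all $y,z\in S$, $(m(x)-\pi_1)^2\ge\delta$, and $\mathbb P(X\in B_{x,\varepsilon})>\tau_x\varepsilon^D$ for all $0<\varepsilon\le\varepsilon_0$,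 where $B_{x,\varepsilon}$ is the closed ball of radius $\varepsilon$ around $x$. Let $\widehat\pi_1=n^{-1}\sum_iY_i$; let $\widehat m_{kNN}(x)$ be the average of the labels of the $k_n$ sample points nearest to $x$ (ties broken by index), and $$\widehat m_{ker}(x)=\frac{\sum_iY_iK((x-X_i)/h_n)}{\sum_iK((x-X_i)/h_n)}\qquad(0/0=0),$$ where $K$ is measurable and $\lambda I(u\in B_{0,r})\le K(u)\le I(u\in B_{0,R})$ for all $u\in\mathbb R^D$, for some $0<\lambda<1$ and $0<r<R$. Put $\widehat{\mathcal T}_{kNN}(x)=(\widehat m_{kNN}(x)-\widehat\pi_1)^2$ and $\widehat{\mathcal T}_{ker}(x)=(\widehat m_{ker}(x)-\widehat\pi_1)^2$. For either statistic $\widehat{\mathcal T}$ let $t_\alpha$ be the upper $\alpha$ quantile of its permutation distribution, i.e. the least $t$ such that at most a fraction $\alpha$ of the $n!$ permutations of $(Y_1,\dots,Y_n)$ (with the $X_i$ fixed) give a value larger than $t$. **Claim.** (i) kNN test: let $k_n$ be $n^{2/(2+D)}$ rounded down or up to an integer. There are positive constants $C_{1,x}$ and $N_x$ such that $$\sup_{(f_0,f_1)\in\mathcal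 M_0}\mathbb P_{f_0,f_1}\big(\widehat{\mathcal T}_{kNN}(x)>t_{\alpha,kNN}\big)\le\alpha\quad\text{for all } n\ge1,$$ $$\sup_{n\ge N_x}\ \sup_{(f_0,f_1)\in\mathcal M_{Lip}(C_{1,x}n^{-2/(2+D)})}\mathbb P_{f_0,f_1}\big(\widehat{\mathcal T}_{kNN}(x)\le t_{\alpha,kNN}\big)\le\beta.$$ (ii) Kernel test: with $h_n=n^{-1/(2+D)}$, for every $\lambda,r,R$ as above there are positive constants $C_{1,x}$ and $N_x$ such that for every kernel $K$ as above the same two bounds hold with $\widehat{\mathcal T}_{ker}(x)$ and $t_{\alpha,ker}$ in place of $\widehat{\mathcal T}_{kNN}(x)$ and $t_{\alpha,kNN}$. (iii) Let $\Phi_{n,\alpha}$ be the set of measurable tests $\phi:(\mathbb R^D\times\{0,1\})^n\to\{0,1\}$ with $\sup_{(f_0,f_1)\in\mathcal M_0}\mathbb P_{f_0,f_1}(\phi=1)\le\alpha$, and let $$\delta^\star_{n,x}=\inf\Big\{\delta\ge 0:\ \inf_{\phi\in\Phi_{n,\alpha}}\ \sup_{(f_0,f_1)\in\mathcal M_{Lip}(\delta)}\mathbb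 P_{f_0,f_1}(\phi=0)\le\beta\Big\}$$ be the minimum separation. Then $\delta^\star_{n,x}\lesssim n^{-2/(2+D)}$: there is $C>0$ with $\delta^\star_{n,x}\le C\,n^{-2/(2+D)}$ for all $n\ge 1$. -/

import Mathlib

open MeasureTheory
open scoped ENNReal

noncomputable section

/-- Feature space `ℝ^D` with the Euclidean norm. -/
abbrev Feat (D : ℕ) : Type := EuclideanSpace ℝ (Fin D)

/-- A labelled sample `(X₁, Y₁), …, (Xₙ, Yₙ)` with `Xᵢ ∈ ℝ^D` and `Yᵢ ∈ {0, 1}`. -/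
abbrev Sample (D n : ℕ) : Type := Fin n → Feat D × Fin 2

/-- A pair of probability densities `f₀, f₁` on `ℝ^D` with respect to a common dominating
measure `ν`. -/
structure DensityPair (D : ℕ) where
  ν : Measure (Feat D)
  f₀ : Feat D → ℝ
  f₁ : Feat D → ℝ
  measurable_f₀ : Measurable f₀
  measurable_f₁ : Measurable f₁
  nonneg_f₀ : ∀ y, 0 ≤ f₀ y
  nonneg_f₁ : ∀ y, 0 ≤ f₁ y
  lintegral_f₀ : ∫⁻ y, ENNReal.ofReal (f₀ y) ∂ν = 1
  lintegral_f₁ : ∫⁻ y, ENNReal.ofReal (f₁ y) ∂ν = 1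

namespace DensityPair

variable {D : ℕ}

/-- The distribution `P₀ = f₀ dν`. -/
def P₀ (M : DensityPair D) : Measure (Feat D) :=
  M.ν.withDensity fun y => ENNReal.ofReal (M.f₀ y)

/-- The distribution `P₁ = f₁ dν`. -/
def P₁ (M : DensityPair D) : Measure (Feat D) :=
  M.ν.withDensity fun y => ENNReal.ofReal (M.f₁ y)

/-- `S = {y : f₀ y + f₁ y > 0}`. -/
def S (M : DensityPair D) : Set (Feat D) := {y | 0 < M.f₀ y + M.f₁ y}

/-- The regression function `m(y) = π₁ f₁(y) / (π₀ f₀(y) + π₁ f₁(y))`, with `π₀ = 1 - π₁`. It is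
meaningful, and only used, on `S`. -/
def reg (M : DensityPair D) (π₁ : ℝ) (y : Feat D) : ℝ :=
  π₁ * M.f₁ y / ((1 - π₁) * M.f₀ y + π₁ * M.f₁ y)

/-- The joint law `π₁ [P₁ × δ₁] + π₀ [P₀ × δ₀]` of `(X, Y)`. -/
def joint (M : DensityPair D) (π₁ : ℝ) : Measure (Feat D × Fin 2) :=
  ENNReal.ofReal π₁ • (M.P₁.prod (Measure.dirac 1))
    + ENNReal.ofReal (1 - π₁) • (M.P₀.prod (Measure.dirac 0))

/-- The law `P_X = π₁ P₁ + π₀ P₀` of `X`. -/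
def lawX (M : DensityPair D) (π₁ : ℝ) : Measure (Feat D) :=
  ENNReal.ofReal π₁ • M.P₁ + ENNReal.ofReal (1 - π₁) • M.P₀

/-- The law of `n` i.i.d. pairs `(Xᵢ, Yᵢ)`. -/
def sampleLaw (M : DensityPair D) (π₁ : ℝ) (n : ℕ) : Measure (Sample D n) :=
  Measure.pi fun _ => M.joint π₁

end DensityPair

/-- The null class `𝓜₀`: `m(y) = π₁` for all `y ∈ S`. -/
def nullClass (D : ℕ) (π₁ : ℝ) : Set (DensityPair D) :=
  {M | ∀ y ∈ M.S, M.reg π₁ y = π₁}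

/-- The Lipschitz class `𝓜_Lip` with constant `L`: `m` is `L`-Lipschitz on `S`. -/
def lipClass (D : ℕ) (π₁ L : ℝ) : Set (DensityPair D) :=
  {M | ∀ y ∈ M.S, ∀ z ∈ M.S, |M.reg π₁ y - M.reg π₁ z| ≤ L * ‖y - z‖}

/-- The local mass condition at `x`: `x ∈ S` and `P(X ∈ B_{x,ε}) > τ ε^D` for all sufficiently
small radii, namely for `0 < ε ≤ ε₀`. -/
def massClass (D : ℕ) (π₁ : ℝ) (x : Feat D) (τ ε₀ : ℝ) : Set (DensityPair D) :=
  {M | x ∈ M.S ∧ ∀ ε : ℝ, 0 < ε → ε ≤ ε₀ →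
    ENNReal.ofReal (τ * ε ^ D) < M.lawX π₁ (Metric.closedBall x ε)}

/-- The Lipschitz local alternatives `𝓜_Lip(δ)` at `x`, under the local mass condition:
`(m(x) - π₁)² ≥ δ`. -/
def lipAlternatives (D : ℕ) (π₁ L : ℝ) (x : Feat D) (τ ε₀ δ : ℝ) : Set (DensityPair D) :=
  {M | M ∈ massClass D π₁ x τ ε₀ ∧ M ∈ lipClass D π₁ L ∧ δ ≤ (M.reg π₁ x - π₁) ^ 2}

/-- The number `0` or `1` given by the `i`-th label. -/
def label {D n : ℕ} (z : Sample D n) (i : Fin n) : ℝ := (((z i).2 : ℕ) : ℝ)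

/-- The empirical class probability `π̂₁`. -/
def piHat {D n : ℕ} (z : Sample D n) : ℝ := (∑ i, label z i) / n

/-- The number of sample points that precede `Xᵢ` when the sample is ordered by the distance to
`x`, ties being broken by the index. So `Xᵢ` is the `(neighborRank x z i + 1)`-th nearest neighbor
of `x`. -/
def neighborRank {D n : ℕ} (x : Feat D) (z : Sample D n) (i : Fin n) : ℕ :=
  (Finset.univ.filter fun j : Fin n =>
    ‖(z j).1 - x‖ < ‖(z i).1 - x‖ ∨ (‖(z j).1 - x‖ = ‖(z i).1 - x‖ ∧ j < i)).card

/-- The `k` nearest neighbor regression estimator at `x`: the average of the labels of the `k`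
nearest neighbors of `x`. -/
def knnEstimator {D n : ℕ} (k : ℕ) (x : Feat D) (z : Sample D n) : ℝ :=
  (∑ i ∈ Finset.univ.filter (fun i : Fin n => neighborRank x z i < k), label z i) / k

/-- The kernel regression estimator at `x` with kernel `K` and bandwidth `h` (with value `0` where
the denominator vanishes). -/
def kernelEstimator {D n : ℕ} (K : Feat D → ℝ) (h : ℝ) (x : Feat D) (z : Sample D n) : ℝ :=
  (∑ i, label z i * K (h⁻¹ • (x - (z i).1))) / ∑ i, K (h⁻¹ • (x - (z i).1))

/-- The local kNN regression test statistic `(m̂_kNN(x) - π̂₁)²`. -/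
def knnStat {D n : ℕ} (k : ℕ) (x : Feat D) (z : Sample D n) : ℝ :=
  (knnEstimator k x z - piHat z) ^ 2

/-- The local kernel regression test statistic `(m̂_ker(x) - π̂₁)²`. -/
def kernelStat {D n : ℕ} (K : Feat D → ℝ) (h : ℝ) (x : Feat D) (z : Sample D n) : ℝ :=
  (kernelEstimator K h x z - piHat z) ^ 2

/-- The sample with labels permuted by `η` and features left in place. -/
def permuteLabels {D n : ℕ} (η : Equiv.Perm (Fin n)) (z : Sample D n) : Sample D n :=
  fun i => ((z i).1, (z (η i)).2)

/-- The upper `α` quantile of the permutation distribution of the statistic `T`: the least `t` for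
which at most a fraction `α` of the `n!` label permutations give a statistic larger than `t`. -/
def permQuantile {D n : ℕ} (α : ℝ) (T : Sample D n → ℝ) (z : Sample D n) : ℝ :=
  sInf {t : ℝ |
    ((Finset.univ.filter fun η : Equiv.Perm (Fin n) => t < T (permuteLabels η z)).card : ℝ)
      / (Fintype.card (Equiv.Perm (Fin n)) : ℝ) ≤ α}

/-- Kernels with `λ 1_{B_{0,r}} ≤ K ≤ 1_{B_{0,R}}`. -/
def kernelClass (D : ℕ) (lam r R : ℝ) : Set (Feat D → ℝ) :=
  {K | Measurable K ∧ ∀ u,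
    lam * (Metric.closedBall (0 : Feat D) r).indicator (fun _ => (1 : ℝ)) u ≤ K u ∧
      K u ≤ (Metric.closedBall (0 : Feat D) R).indicator (fun _ => (1 : ℝ)) u}

/-- The worst case probability `sup_{f₀,f₁ ∈ 𝓒} P_{f₀,f₁}(A)` of an event `A` about `n` i.i.d.
pairs. -/
def worstProb {D n : ℕ} (π₁ : ℝ) (𝓒 : Set (DensityPair D)) (A : Set (Sample D n)) : ℝ≥0∞ :=
  ⨆ M ∈ 𝓒, M.sampleLaw π₁ n A

/-- The class `Φ_{n,α}` of level `α` tests, as measurable functions of the sample into `{0, 1}`. -/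
def levelTests (D n : ℕ) (π₁ α : ℝ) : Set (Sample D n → Fin 2) :=
  {φ | Measurable φ ∧ worstProb π₁ (nullClass D π₁) {z | φ z = 1} ≤ ENNReal.ofReal α}

/-- The minimax type II error of level `α` tests over the class `𝓒`. -/
def minimaxTypeII (D n : ℕ) (π₁ α : ℝ) (𝓒 : Set (DensityPair D)) : ℝ≥0∞ :=
  ⨅ φ ∈ levelTests D n π₁ α, worstProb π₁ 𝓒 {z | φ z = 0}

/-- The minimum separation `δ⋆_{n,x}`, the infimum of the `δ ≥ 0` for which the minimax type II
error of level `α` tests over `𝓜_Lip(δ)` is at most `β`. The infimum is taken in `[0, ∞]`. -/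
def minSeparation (D n : ℕ) (π₁ L : ℝ) (x : Feat D) (τ ε₀ α β : ℝ) : ℝ≥0∞ :=
  sInf (ENNReal.ofReal '' {δ : ℝ | 0 ≤ δ ∧
    minimaxTypeII D n π₁ α (lipAlternatives D π₁ L x τ ε₀ δ) ≤ ENNReal.ofReal β})

end

/-!
The level bound holds at every sample size: under the null `f₀ = f₁`, so features and labels are
independent, the sample law is invariant under label permutations, and the rejection region meets
each orbit in at most a fraction `α` (`worstProb_nullClass_le`).

For the power, both statistics are `(∑ wᵢ Yᵢ - π̂₁)²` with nonnegative weights `wᵢ` that depend on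
the features only (`linearStat`). Suppose that `∑ wᵢ = 1` and `∑ wᵢ² ≤ q`, and that `w` lives on
points within `ρ` of `x`.

* Over the label permutations, the mean of `∑ wᵢ Y_η(i)` is `π̂₁` and its variance is at most `q`,
  because sampling without replacement correlates the labels nonpositively (`sum_perm_sq_le`).
  Markov's inequality bounds the critical value by `q / α` (`permQuantile_linearStat_le`).
* Given the features, the noise `∑ wᵢ (Yᵢ - m(Xᵢ))` has variance at most `q`
  (`measureReal_noise_le`), the bias `∑ wᵢ m(Xᵢ) - m(x)` is at most `L ρ`, and `π̂₁ - π₁` has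
  variance at most `1 / n`.

So the test rejects with high probability once `|m(x) - π₁|` exceeds a multiple of
`√q + n^(-1/2) + L ρ` (`sampleLaw_linearStat_le`). A ball of radius of the order
`b = n^(-1/(2+D))` around `x` holds at least of the order of `n b^D = b⁻²` sample points, with high
probability by Chebyshev's inequality (`measureReal_hits_lt_le`). On that event `ρ` has the order
`b` and `q` the order `b²` for both sets of weights, so a separation of the order
`b² = n^(-2/(2+D))` suffices (`exists_worstProb_linearStat_le`).

The minimum separation is at most the one of the nearest neighbor test for large `n`, and at most
`2` always, since no alternative is further apart than that.
-/

/-! ### Second moments under random permutations -/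

section Permutation

variable {n : ℕ}

/-- Two distinct values of a centred population drawn without replacement are nonpositively
correlated. -/
theorem sum_perm_mul_nonpos {c : Fin n → ℝ} (hc : ∑ i, c i = 0) {i j : Fin n} (hij : i ≠ j) :
    ∑ η : Equiv.Perm (Fin n), c (η i) * c (η j) ≤ 0 := by
  have hsym : ∀ l, l ≠ i →
      ∑ η : Equiv.Perm (Fin n), c (η i) * c (η l) = ∑ η : Equiv.Perm (Fin n), c (η i) * c (η j) := by
    intro l hl
    refine Fintype.sum_equiv (Equiv.mulRight (Equiv.swap j l)) _ _ fun η => ?_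
    simp [Equiv.swap_apply_of_ne_of_ne hij hl.symm]
  have htot : ∑ l, ∑ η : Equiv.Perm (Fin n), c (η i) * c (η l) = 0 := by
    rw [Finset.sum_comm]
    refine Finset.sum_eq_zero fun η _ => ?_
    rw [← Finset.mul_sum, Equiv.sum_comp η c, hc, mul_zero]
  rw [← Finset.add_sum_erase _ _ (Finset.mem_univ i),
    Finset.sum_congr rfl fun l hl => hsym l (Finset.ne_of_mem_erase hl), Finset.sum_const,
    nsmul_eq_mul] at htot
  have hpos : (0 : ℝ) < ((Finset.univ.erase i).card : ℝ) :=
    Nat.cast_pos.2 (Finset.card_pos.2 ⟨j, by simp [hij.symm]⟩)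
  have hsq : 0 ≤ ∑ η : Equiv.Perm (Fin n), c (η i) * c (η i) :=
    Finset.sum_nonneg fun η _ => mul_self_nonneg _
  nlinarith

/-- The second moment of a nonnegatively weighted sum over a random permutation of a centred
population with values in `[-1, 1]`: the negative correlations may be dropped. -/
theorem sum_perm_sq_le {c w : Fin n → ℝ} (hc : ∑ i, c i = 0) (hc1 : ∀ i, |c i| ≤ 1)
    (hw : ∀ i, 0 ≤ w i) :
    ∑ η : Equiv.Perm (Fin n), (∑ i, w i * c (η i)) ^ 2
      ≤ Fintype.card (Equiv.Perm (Fin n)) * ∑ i, w i ^ 2 := by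
  have hexp : ∑ η : Equiv.Perm (Fin n), (∑ i, w i * c (η i)) ^ 2
      = ∑ i, ∑ j, w i * w j * ∑ η : Equiv.Perm (Fin n), c (η i) * c (η j) := by
    simp_rw [sq, Finset.sum_mul_sum, Finset.mul_sum]
    rw [Finset.sum_comm]
    refine Finset.sum_congr rfl fun i _ => ?_
    rw [Finset.sum_comm]
    exact Finset.sum_congr rfl fun j _ => Finset.sum_congr rfl fun η _ => by ring
  rw [hexp, Finset.mul_sum]
  refine Finset.sum_le_sum fun i _ => ?_
  rw [← Finset.add_sum_erase _ _ (Finset.mem_univ i)]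
  have h1 : ∑ j ∈ Finset.univ.erase i,
      w i * w j * ∑ η : Equiv.Perm (Fin n), c (η i) * c (η j) ≤ 0 :=
    Finset.sum_nonpos fun j hj => mul_nonpos_of_nonneg_of_nonpos (mul_nonneg (hw i) (hw j))
      (sum_perm_mul_nonpos hc (Finset.ne_of_mem_erase hj).symm)
  have h2 : ∑ η : Equiv.Perm (Fin n), c (η i) * c (η i) ≤ Fintype.card (Equiv.Perm (Fin n)) := by
    have : ∀ η ∈ (Finset.univ : Finset (Equiv.Perm (Fin n))), c (η i) * c (η i) ≤ 1 := by
      intro η _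
      have := abs_le.1 (hc1 (η i))
      nlinarith
    simpa using Finset.sum_le_sum this
  have h3 := mul_le_mul_of_nonneg_left h2 (mul_nonneg (hw i) (hw i))
  nlinarith

end Permutation

/-! ### The permutation quantile -/

section Quantile

variable {D n : ℕ} {α : ℝ} (T : Sample D n → ℝ) (z : Sample D n)

/-- The proportion of the label permutations at which the statistic exceeds `t`. -/
noncomputable def permTail (t : ℝ) : ℝ :=
  ((Finset.univ.filter fun η : Equiv.Perm (Fin n) => t < T (permuteLabels η z)).card : ℝ)
      / (Fintype.card (Equiv.Perm (Fin n)) : ℝ)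

theorem permQuantile_eq_sInf : permQuantile α T z = sInf {t | permTail T z t ≤ α} := rfl

theorem permCard_pos : (0 : ℝ) < (Fintype.card (Equiv.Perm (Fin n)) : ℝ) :=
  Nat.cast_pos.2 Fintype.card_pos

theorem permTail_antitone : Antitone (permTail T z) := by
  intro s t hst
  unfold permTail
  gcongr

theorem bddBelow_permTail_le (hα : α < 1) : BddBelow {t | permTail T z t ≤ α} := by
  obtain ⟨b, hb⟩ := (Set.finite_range fun η : Equiv.Perm (Fin n) => T (permuteLabels η z)).bddBelow
  refine ⟨b, fun t ht => ?_⟩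
  by_contra! hlt
  have : permTail T z t = 1 := by
    unfold permTail
    rw [Finset.filter_true_of_mem fun η _ => hlt.trans_le (hb ⟨η, rfl⟩), Finset.card_univ]
    exact div_self permCard_pos.ne'
  rw [Set.mem_ofPred_eq, this] at ht
  linarith

/-- The infimum defining the permutation quantile is attained, since `permTail` is a right
continuous step function. -/
theorem permTail_permQuantile_le (hα : 0 < α) : permTail T z (permQuantile α T z) ≤ α := by
  set q := permQuantile α T z with hq
  have hne : {t | permTail T z t ≤ α}.Nonempty := by
    obtain ⟨b, hb⟩ :=
      (Set.finite_range fun η : Equiv.Perm (Fin n) => T (permuteLabels η z)).bddAbove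
    refine ⟨b, ?_⟩
    have : permTail T z b = 0 := by
      unfold permTail
      rw [Finset.filter_false_of_mem fun η _ => not_lt.2 (hb ⟨η, rfl⟩)]
      simp
    rw [Set.mem_ofPred_eq, this]
    exact hα.le
  -- No value of the statistic lies in `(q, t]` for some `t > q`.
  obtain ⟨t, hqt, ht⟩ : ∃ t, q < t ∧ ∀ η : Equiv.Perm (Fin n),
      q < T (permuteLabels η z) → t < T (permuteLabels η z) := by
    have hev : ∀ᶠ t in nhdsWithin q (Set.Ioi q), ∀ η : Equiv.Perm (Fin n),
        q < T (permuteLabels η z) → t < T (permuteLabels η z) := by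
      rw [Filter.eventually_all]
      intro η
      by_cases h : q < T (permuteLabels η z)
      · filter_upwards [Ioo_mem_nhdsGT h] with t ht _ using ht.2
      · exact Filter.Eventually.of_forall fun t h' => absurd h' h
    obtain ⟨t, h1, h2⟩ := (hev.and self_mem_nhdsWithin).exists
    exact ⟨t, h2, h1⟩
  obtain ⟨s, hs, hst⟩ := exists_lt_of_csInf_lt hne (show sInf {t | permTail T z t ≤ α} < t from hqt)
  have hle : permTail T z q ≤ permTail T z t := by
    unfold permTail
    exact div_le_div_of_nonneg_right (Nat.cast_le.2 (Finset.card_le_card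
      (Finset.monotone_filter_right _ fun η _ h => ht η h))) permCard_pos.le
  exact hle.trans ((permTail_antitone T z hst.le).trans hs)

theorem permQuantile_le_iff (hα : 0 < α ∧ α < 1) {t : ℝ} :
    permQuantile α T z ≤ t ↔ permTail T z t ≤ α :=
  ⟨fun h => (permTail_antitone T z h).trans (permTail_permQuantile_le T z hα.1),
    fun h => csInf_le (bddBelow_permTail_le T z hα.2) h⟩

theorem permTail_permuteLabels (η : Equiv.Perm (Fin n)) (t : ℝ) :
    permTail T (permuteLabels η z) t = permTail T z t := by
  unfold permTail
  congr 2
  refine Finset.card_equiv (Equiv.mulLeft η) fun η' => ?_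
  rw [Finset.mem_filter_univ, Finset.mem_filter_univ]
  rfl

theorem permQuantile_permuteLabels (η : Equiv.Perm (Fin n)) :
    permQuantile α T (permuteLabels η z) = permQuantile α T z := by
  simp_rw [permQuantile_eq_sInf, permTail_permuteLabels]

theorem measurable_permuteLabels (η : Equiv.Perm (Fin n)) :
    Measurable (permuteLabels (D := D) η) := by
  unfold permuteLabels
  fun_prop

variable {T}

theorem measurable_permTail (hT : Measurable T) (t : ℝ) :
    Measurable fun z => permTail T z t := by
  have : (fun z => permTail T z t) = fun z => (∑ η : Equiv.Perm (Fin n),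
      {z | t < T (permuteLabels η z)}.indicator (fun _ => (1 : ℝ)) z)
        / (Fintype.card (Equiv.Perm (Fin n)) : ℝ) := by
    ext z
    simp [permTail, Set.indicator_apply]
  rw [this]
  refine Measurable.div_const (Finset.measurable_sum _ fun η _ => ?_) _
  exact measurable_const.indicator
    (measurableSet_lt measurable_const (hT.comp (measurable_permuteLabels η)))

theorem measurable_permQuantile (hα : 0 < α ∧ α < 1) (hT : Measurable T) :
    Measurable (permQuantile α T) := by
  refine measurable_of_Iic fun t => ?_
  have : permQuantile α T ⁻¹' Set.Iic t = {z | permTail T z t ≤ α} := by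
    ext z
    exact permQuantile_le_iff T z hα
  rw [this]
  exact measurableSet_le (measurable_permTail hT t) measurable_const

/-- Markov's inequality for the permutation distribution. -/
theorem permQuantile_le_of_sum_le (hα : 0 < α ∧ α < 1) (hT : ∀ z, 0 ≤ T z) {q : ℝ} (hq : 0 < q)
    (h : ∑ η : Equiv.Perm (Fin n), T (permuteLabels η z)
      ≤ Fintype.card (Equiv.Perm (Fin n)) * q) :
    permQuantile α T z ≤ q / α := by
  rw [permQuantile_le_iff T z hα, permTail, div_le_iff₀ permCard_pos]
  have h1 : ((Finset.univ.filter
      fun η : Equiv.Perm (Fin n) => q / α < T (permuteLabels η z)).card : ℝ) * (q / α)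
      ≤ ∑ η : Equiv.Perm (Fin n), T (permuteLabels η z) := by
    rw [← nsmul_eq_mul, ← Finset.sum_const]
    exact (Finset.sum_le_sum fun η hη => (Finset.mem_filter.1 hη).2.le).trans
      (Finset.sum_le_sum_of_subset_of_nonneg (Finset.filter_subset _ _) fun _ _ _ => hT _)
  have h2 := h1.trans h
  rw [mul_div_assoc', div_le_iff₀ hα.1] at h2
  nlinarith

end Quantile

/-! ### Level of permutation tests -/

section Level

variable {D n : ℕ} {π₁ α : ℝ}

instance (M : DensityPair D) : IsProbabilityMeasure M.P₀ :=
  ⟨by rw [DensityPair.P₀, withDensity_apply _ .univ, Measure.restrict_univ, M.lintegral_f₀]⟩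

instance (M : DensityPair D) : IsProbabilityMeasure M.P₁ :=
  ⟨by rw [DensityPair.P₁, withDensity_apply _ .univ, Measure.restrict_univ, M.lintegral_f₁]⟩

theorem ofReal_add_ofReal_one_sub (hπ : 0 < π₁ ∧ π₁ < 1) :
    ENNReal.ofReal π₁ + ENNReal.ofReal (1 - π₁) = 1 := by
  rw [← ENNReal.ofReal_add hπ.1.le (by linarith [hπ.2])]
  simp

theorem isProbabilityMeasure_joint (hπ : 0 < π₁ ∧ π₁ < 1) (M : DensityPair D) :
    IsProbabilityMeasure (M.joint π₁) :=
  ⟨by simp [DensityPair.joint, ofReal_add_ofReal_one_sub hπ]⟩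

/-- The Bernoulli law with success probability `p`. -/
noncomputable def bernoulliLaw (p : ℝ) : Measure (Fin 2) :=
  ENNReal.ofReal p • Measure.dirac 1 + ENNReal.ofReal (1 - p) • Measure.dirac 0

theorem isProbabilityMeasure_bernoulliLaw (hπ : 0 < π₁ ∧ π₁ < 1) :
    IsProbabilityMeasure (bernoulliLaw π₁) :=
  ⟨by simp [bernoulliLaw, ofReal_add_ofReal_one_sub hπ]⟩

/-- Under the null the two class densities agree, so features and labels are independent. -/
theorem joint_eq_prod_of_mem_nullClass (hπ : 0 < π₁ ∧ π₁ < 1) {M : DensityPair D}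
    (hM : M ∈ nullClass D π₁) : M.joint π₁ = M.P₀.prod (bernoulliLaw π₁) := by
  have hf : M.f₁ = M.f₀ := by
    ext y
    have h0 := M.nonneg_f₀ y
    have h1 := M.nonneg_f₁ y
    by_cases hy : y ∈ M.S
    · have h := hM y hy
      have hy' : 0 < M.f₀ y + M.f₁ y := hy
      have hden : 0 < (1 - π₁) * M.f₀ y + π₁ * M.f₁ y := by
        rcases h0.eq_or_lt with h0' | h0'
        · nlinarith [mul_pos hπ.1 (show 0 < M.f₁ y by linarith)]
        · nlinarith [mul_pos (sub_pos.2 hπ.2) h0', mul_nonneg hπ.1.le h1]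
      rw [DensityPair.reg, div_eq_iff hden.ne'] at h
      have h' := mul_left_cancel₀ hπ.1.ne' h
      have : (1 - π₁) * M.f₁ y = (1 - π₁) * M.f₀ y := by linarith
      exact mul_left_cancel₀ (sub_pos.2 hπ.2).ne' this
    · have : ¬ 0 < M.f₀ y + M.f₁ y := hy
      linarith
  have hP : M.P₁ = M.P₀ := by rw [DensityPair.P₁, DensityPair.P₀, hf]
  rw [DensityPair.joint, hP, bernoulliLaw, Measure.prod_add, Measure.prod_smul_right,
    Measure.prod_smul_right]

theorem measurePreserving_permuteLabels (hπ : 0 < π₁ ∧ π₁ < 1) {M : DensityPair D}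
    (hM : M ∈ nullClass D π₁) (η : Equiv.Perm (Fin n)) :
    MeasurePreserving (permuteLabels η) (M.sampleLaw π₁ n) (M.sampleLaw π₁ n) := by
  have := isProbabilityMeasure_bernoulliLaw hπ
  rw [DensityPair.sampleLaw, joint_eq_prod_of_mem_nullClass hπ hM]
  have h1 := measurePreserving_arrowProdEquivProdArrow (Feat D) (Fin 2) (Fin n)
    (fun _ => M.P₀) (fun _ => bernoulliLaw π₁)
  have h2 := measurePreserving_piCongrLeft (fun _ : Fin n => bernoulliLaw π₁) η.symm
  have h3 := (MeasurePreserving.id (Measure.pi fun _ : Fin n => M.P₀)).prod h2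
  have h4 := (h1.symm _).comp (h3.comp h1)
  convert h4 using 1
  funext z i
  refine Prod.ext rfl ?_
  change (z (η i)).2 = (Equiv.piCongrLeft (fun _ : Fin n => Fin 2) η.symm) (fun j => (z j).2) i
  rw [Equiv.piCongrLeft_apply]
  simp

/-- A permutation test has level `α` at every sample size: under the null the sample law is
invariant under label permutations, and the rejection region contains at most a fraction `α` of
each orbit. -/
theorem worstProb_nullClass_le (hπ : 0 < π₁ ∧ π₁ < 1) (hα : 0 < α ∧ α < 1)
    {T : Sample D n → ℝ} (hT : Measurable T) :
    worstProb π₁ (nullClass D π₁) {z : Sample D n | T z > permQuantile α T z}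
      ≤ ENNReal.ofReal α := by
  refine iSup₂_le fun M hM => ?_
  have := isProbabilityMeasure_joint hπ M
  have : IsProbabilityMeasure (M.sampleLaw π₁ n) := by
    unfold DensityPair.sampleLaw; infer_instance
  set μ := M.sampleLaw π₁ n
  set A := {z : Sample D n | T z > permQuantile α T z} with hA
  have hAm : MeasurableSet A := measurableSet_lt (measurable_permQuantile hα hT) hT
  have hcount : ∀ z, ∑ η : Equiv.Perm (Fin n),
      (permuteLabels η ⁻¹' A).indicator (fun _ => (1 : ℝ≥0∞)) z
        ≤ ENNReal.ofReal (α * Fintype.card (Equiv.Perm (Fin n))) := by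
    intro z
    have h1 := permTail_permQuantile_le T z hα.1
    rw [permTail, div_le_iff₀ permCard_pos] at h1
    have hind : ∀ η : Equiv.Perm (Fin n),
        (permuteLabels η ⁻¹' A).indicator (fun _ => (1 : ℝ≥0∞)) z
          = if permQuantile α T z < T (permuteLabels η z) then 1 else 0 := by
      intro η
      classical
      rw [Set.indicator_apply]
      refine if_congr ?_ rfl rfl
      rw [← permQuantile_permuteLabels T z η]
      rfl
    rw [Finset.sum_congr rfl fun η _ => hind η, Finset.sum_boole, ← ENNReal.ofReal_natCast]
    exact ENNReal.ofReal_le_ofReal h1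
  have hsum : (Fintype.card (Equiv.Perm (Fin n)) : ℝ≥0∞) * μ A
      ≤ ENNReal.ofReal (α * Fintype.card (Equiv.Perm (Fin n))) := by
    calc (Fintype.card (Equiv.Perm (Fin n)) : ℝ≥0∞) * μ A
        = ∑ η : Equiv.Perm (Fin n), μ (permuteLabels η ⁻¹' A) := by
          rw [Finset.sum_congr rfl fun η _ => (measurePreserving_permuteLabels hπ hM
            η).measure_preimage hAm.nullMeasurableSet]
          rw [Finset.sum_const, Finset.card_univ, nsmul_eq_mul]
      _ = ∫⁻ z, ∑ η : Equiv.Perm (Fin n),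
          (permuteLabels η ⁻¹' A).indicator (fun _ => (1 : ℝ≥0∞)) z ∂μ := by
          rw [lintegral_finsetSum _ fun η _ =>
            measurable_const.indicator (measurable_permuteLabels η hAm)]
          refine Finset.sum_congr rfl fun η _ => ?_
          rw [lintegral_indicator_const (measurable_permuteLabels η hAm), one_mul]
      _ ≤ ∫⁻ _, ENNReal.ofReal (α * Fintype.card (Equiv.Perm (Fin n))) ∂μ :=
          lintegral_mono hcount
      _ = _ := by simp
  rw [ENNReal.ofReal_mul hα.1.le, ENNReal.ofReal_natCast, mul_comm] at hsum
  exact (ENNReal.mul_le_mul_iff_left (by simp [Fintype.card_ne_zero]) (by simp)).1 hsum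

end Level

/-! ### Integration of one coordinate of an i.i.d. sample -/

section Coordinate

variable {E : Type*} [MeasurableSpace E] {μ : Measure E} [IsProbabilityMeasure μ] {n : ℕ}

/-- An integral over an i.i.d. sample vanishes when integrating out one coordinate already gives
zero. -/
theorem integral_pi_eq_zero_of_update {F : (Fin n → E) → ℝ}
    (hF : Integrable F (Measure.pi fun _ => μ)) (j : Fin n)
    (h : ∀ z, ∫ s, F (Function.update z j s) ∂μ = 0) :
    ∫ z, F z ∂(Measure.pi fun _ => μ) = 0 := by
  cases n with
  | zero => exact j.elim0
  | succ n =>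
    have hmp := (measurePreserving_piFinSuccAbove (fun _ : Fin (n + 1) => μ) j).symm _
    rw [← hmp.integral_comp' F, integral_prod_symm
      (fun p => F ((MeasurableEquiv.piFinSuccAbove (fun _ => E) j).symm p))
      (hmp.integrable_comp_of_integrable hF)]
    refine integral_eq_zero_of_ae (Filter.Eventually.of_forall fun y => ?_)
    obtain ⟨s₀⟩ : Nonempty E := nonempty_of_isProbabilityMeasure μ
    have h1 := h (j.insertNth s₀ y)
    simp_rw [Fin.update_insertNth] at h1
    exact h1

/-- A function bounded by a constant is integrable for a probability measure. -/
theorem integrable_of_measurable_of_abs_le {f : E → ℝ} (hf : Measurable f) {C : ℝ}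
    (h : ∀ s, |f s| ≤ C) : Integrable f μ :=
  Integrable.of_bound hf.aestronglyMeasurable C (Filter.Eventually.of_forall h)

/-- The second moment of a sum of bounded pairwise orthogonal random variables. -/
theorem integral_sum_sq_of_orthogonal {ι : Type*} [Fintype ι] {V : ι → E → ℝ} {C : ℝ}
    (hV : ∀ i, Measurable (V i)) (hC : ∀ i s, |V i s| ≤ C)
    (ho : ∀ i j, i ≠ j → ∫ s, V i s * V j s ∂μ = 0) :
    ∫ s, (∑ i, V i s) ^ 2 ∂μ = ∫ s, ∑ i, V i s ^ 2 ∂μ := by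
  have hint : ∀ i j, Integrable (fun s => V i s * V j s) μ := fun i j =>
    integrable_of_measurable_of_abs_le ((hV i).mul (hV j)) (C := C * C) fun s => by
      rw [abs_mul]
      exact mul_le_mul (hC i s) (hC j s) (abs_nonneg _) ((abs_nonneg _).trans (hC i s))
  simp_rw [sq, Finset.sum_mul_sum]
  rw [integral_finsetSum _ fun i _ => integrable_finsetSum _ fun j _ => hint i j,
    integral_finsetSum _ fun i _ => hint i i]
  refine Finset.sum_congr rfl fun i _ => ?_
  rw [integral_finsetSum _ fun j _ => hint i j, Finset.sum_eq_single i
    (fun j _ hj => ho i j hj.symm) (by simp)]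

/-- Chebyshev's inequality for a sum of bounded pairwise orthogonal random variables. -/
theorem measureReal_le_abs_sum_le {ι : Type*} [Fintype ι] {V : ι → E → ℝ} {C q t : ℝ}
    (hV : ∀ i, Measurable (V i)) (hC : ∀ i s, |V i s| ≤ C)
    (ho : ∀ i j, i ≠ j → ∫ s, V i s * V j s ∂μ = 0)
    (hq : ∫ s, ∑ i, V i s ^ 2 ∂μ ≤ q) (ht : 0 < t) :
    μ.real {s | t ≤ |∑ i, V i s|} ≤ q / t ^ 2 := by
  have hm : Measurable fun s => ∑ i, V i s := Finset.measurable_sum _ fun i _ => hV i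
  have hb : ∀ s, |∑ i, V i s| ≤ Fintype.card ι * C := fun s =>
    (Finset.abs_sum_le_sum_abs _ _).trans <| by
      simpa using Finset.sum_le_sum fun i (_ : i ∈ Finset.univ) => hC i s
  have hint : Integrable (fun s => (∑ i, V i s) ^ 2) μ :=
    integrable_of_measurable_of_abs_le (hm.pow_const 2) (C := (Fintype.card ι * C) ^ 2) fun s => by
      rw [abs_pow]
      exact pow_le_pow_left₀ (abs_nonneg _) (hb s) 2
  have hmarkov := mul_meas_ge_le_integral_of_nonneg (μ := μ)
    (Filter.Eventually.of_forall fun s => sq_nonneg (∑ i, V i s)) hint (t ^ 2)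
  rw [integral_sum_sq_of_orthogonal hV hC ho] at hmarkov
  rw [le_div_iff₀ (by positivity), mul_comm]
  refine le_trans ?_ (hmarkov.trans hq)
  refine mul_le_mul_of_nonneg_left (measureReal_mono fun s hs => ?_) (sq_nonneg t)
  have hs' : t ≤ |∑ i, V i s| := hs
  change t ^ 2 ≤ (∑ i, V i s) ^ 2
  rw [← sq_abs (∑ i, V i s)]
  exact pow_le_pow_left₀ ht.le hs' 2

/-- Chebyshev's inequality for a sum of i.i.d. centred variables `u (zᵢ)`. -/
theorem measureReal_pi_le_abs_sum_le {u : E → ℝ} {q t : ℝ} (hu : Measurable u)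
    (hu1 : ∀ s, |u s| ≤ 1) (hu0 : ∫ s, u s ∂μ = 0) (hq : ∫ s, u s ^ 2 ∂μ ≤ q) (ht : 0 < t) :
    (Measure.pi fun _ : Fin n => μ).real {z | t ≤ |∑ i, u (z i)|} ≤ n * q / t ^ 2 := by
  have hum : ∀ i : Fin n, Measurable fun z : Fin n → E => u (z i) := fun i =>
    hu.comp (measurable_pi_apply i)
  refine measureReal_le_abs_sum_le hum (fun i z => hu1 _) (fun i j hij => ?_) ?_ ht
  · refine integral_pi_eq_zero_of_update (integrable_of_measurable_of_abs_le
      ((hum i).mul (hum j)) (C := 1) fun z => ?_) j fun z => ?_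
    · rw [abs_mul]
      exact mul_le_one₀ (hu1 _) (abs_nonneg _) (hu1 _)
    · simp [Function.update_of_ne hij, integral_const_mul, hu0]
  · have hsq : Integrable (fun s => u s ^ 2) μ :=
      integrable_of_measurable_of_abs_le (hu.pow_const 2) (C := 1) fun s => by
        rw [abs_pow]
        exact pow_le_one₀ (abs_nonneg _) (hu1 s)
    rw [integral_finsetSum _ fun i _ => integrable_of_measurable_of_abs_le
      ((hum i).pow_const 2) (C := 1) fun s => by
        rw [abs_pow]
        exact pow_le_one₀ (abs_nonneg _) (hu1 _)]
    have h1 : ∀ i : Fin n, ∫ z, u (z i) ^ 2 ∂(Measure.pi fun _ : Fin n => μ)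
        = ∫ s, u s ^ 2 ∂μ := fun i =>
      integral_comp_eval (μ := fun _ : Fin n => μ) (i := i) hsq.aestronglyMeasurable
    rw [Finset.sum_congr rfl fun i _ => h1 i, Finset.sum_const, Finset.card_univ,
      Fintype.card_fin, nsmul_eq_mul]
    exact mul_le_mul_of_nonneg_left hq (Nat.cast_nonneg n)

/-- The number of sample points in `B`. -/
noncomputable def hits (B : Set E) (z : Fin n → E) : ℝ := ∑ i, B.indicator (fun _ => (1 : ℝ)) (z i)

theorem measurable_hits {B : Set E} (hB : MeasurableSet B) :
    Measurable (hits B : (Fin n → E) → ℝ) :=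
  Finset.measurable_sum _ fun i _ =>
    (measurable_const.indicator hB).comp (measurable_pi_apply i)

/-- The number of sample points in a set of probability at least `p` is rarely below half of
`n p`. -/
theorem measureReal_hits_lt_le {B : Set E} (hB : MeasurableSet B) {p : ℝ} (hp : 0 < p)
    (hpB : p ≤ μ.real B) (hn : 0 < n) :
    (Measure.pi fun _ : Fin n => μ).real {z | hits B z < n * p / 2} ≤ 4 / (n * p) := by
  set P := μ.real B with hP
  have hP0 : 0 < P := hp.trans_le hpB
  have hP1 : P ≤ 1 := measureReal_le_one
  have hn' : (0 : ℝ) < n := Nat.cast_pos.2 hn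
  set u : E → ℝ := fun s => B.indicator (fun _ => (1 : ℝ)) s - P with hu_def
  have hI : Measurable (B.indicator (fun _ => (1 : ℝ))) := measurable_const.indicator hB
  have hIint : Integrable (B.indicator (fun _ => (1 : ℝ))) μ :=
    (integrable_const 1).indicator hB
  have hIP : ∫ s, B.indicator (fun _ => (1 : ℝ)) s ∂μ = P := by
    rw [integral_indicator_const _ hB]; simp [hP]
  have hu1 : ∀ s, |u s| ≤ 1 := by
    intro s
    by_cases hs : s ∈ B <;> simp only [hu_def, hs, Set.indicator_of_mem, not_false_eq_true,
      Set.indicator_of_notMem] <;> rw [abs_le] <;> constructor <;> linarith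
  have hu0 : ∫ s, u s ∂μ = 0 := by
    rw [hu_def, integral_sub hIint (integrable_const _), hIP]; simp
  have hsq : ∫ s, u s ^ 2 ∂μ ≤ P := by
    have h1 : ∀ s, u s ^ 2 = (1 - 2 * P) * B.indicator (fun _ => (1 : ℝ)) s + P ^ 2 := by
      intro s
      by_cases hs : s ∈ B <;> simp only [hu_def, hs, Set.indicator_of_mem, not_false_eq_true,
        Set.indicator_of_notMem] <;> ring
    simp_rw [h1]
    rw [integral_add (hIint.const_mul _) (integrable_const _), integral_const_mul, hIP]
    simp only [integral_const, probReal_univ, smul_eq_mul]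
    nlinarith
  have h := measureReal_pi_le_abs_sum_le (n := n) (μ := μ) (hI.sub_const P) hu1 hu0 hsq
    (t := n * P / 2) (by positivity)
  calc _ ≤ _ := measureReal_mono (fun z hz => ?_)
    _ ≤ _ := h
    _ = 4 / (n * P) := by field_simp; norm_num
    _ ≤ _ := by gcongr
  have hz' : hits B z < n * p / 2 := hz
  change n * P / 2 ≤ |∑ i, (B.indicator (fun _ => (1 : ℝ)) (z i) - P)|
  rw [Finset.sum_sub_distrib, Finset.sum_const, Finset.card_univ, Fintype.card_fin, nsmul_eq_mul]
  change n * P / 2 ≤ |hits B z - n * P|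
  have : (n : ℝ) * p ≤ n * P := by gcongr
  rw [abs_sub_comm]
  exact le_trans (by linarith) (le_abs_self _)

end Coordinate

/-! ### The regression function as a conditional mean -/

section Regression

variable {D n : ℕ} {π₁ : ℝ} {M : DensityPair D}

theorem DensityPair.measurableSet_S (M : DensityPair D) : MeasurableSet M.S :=
  measurableSet_lt measurable_const (M.measurable_f₀.add M.measurable_f₁)

theorem DensityPair.measurable_reg (M : DensityPair D) (π₁ : ℝ) : Measurable (M.reg π₁) := by
  have h0 := M.measurable_f₀
  have h1 := M.measurable_f₁
  unfold DensityPair.reg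
  fun_prop

/-- The regression function is in `[0, 1]` everywhere; off `S` it is `0 / 0 = 0`. -/
theorem DensityPair.reg_mem_Icc (hπ : 0 < π₁ ∧ π₁ < 1) (M : DensityPair D) (y : Feat D) :
    M.reg π₁ y ∈ Set.Icc (0 : ℝ) 1 := by
  have h0 := mul_nonneg (sub_pos.2 hπ.2).le (M.nonneg_f₀ y)
  have h1 := mul_nonneg hπ.1.le (M.nonneg_f₁ y)
  exact ⟨div_nonneg h1 (add_nonneg h0 h1), div_le_one_of_le₀ (by linarith) (add_nonneg h0 h1)⟩

/-- The defining balance `π₁ f₁ (1 - m) = π₀ f₀ m` of the regression function. -/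
theorem DensityPair.reg_balance (hπ : 0 < π₁ ∧ π₁ < 1) (M : DensityPair D) (y : Feat D) :
    π₁ * M.f₁ y * (1 - M.reg π₁ y) = (1 - π₁) * M.f₀ y * M.reg π₁ y := by
  have h0 := mul_nonneg (sub_pos.2 hπ.2).le (M.nonneg_f₀ y)
  have h1 := mul_nonneg hπ.1.le (M.nonneg_f₁ y)
  rcases (add_nonneg h0 h1).eq_or_lt with h | h
  · have e0 : (1 - π₁) * M.f₀ y = 0 := by linarith
    have e1 : π₁ * M.f₁ y = 0 := by linarith
    rw [e0, e1, zero_mul, zero_mul]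
  · have : M.reg π₁ y * ((1 - π₁) * M.f₀ y + π₁ * M.f₁ y) = π₁ * M.f₁ y :=
      div_mul_cancel₀ _ h.ne'
    linear_combination (-1 : ℝ) * this

theorem DensityPair.integral_joint (hπ : 0 < π₁ ∧ π₁ < 1) (M : DensityPair D)
    {F : Feat D × Fin 2 → ℝ} (hF : Measurable F) {C : ℝ} (hC : ∀ s, |F s| ≤ C) :
    ∫ s, F s ∂(M.joint π₁) = π₁ * ∫ y, F (y, 1) ∂M.P₁ + (1 - π₁) * ∫ y, F (y, 0) ∂M.P₀ := by
  have key : ∀ (P : Measure (Feat D)) [IsProbabilityMeasure P] (b : Fin 2),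
      ∫ s, F s ∂(P.prod (Measure.dirac b)) = ∫ y, F (y, b) ∂P := by
    intro P _ b
    rw [Measure.prod_dirac, integral_map (by fun_prop) hF.aestronglyMeasurable]
  rw [DensityPair.joint, integral_add_measure, integral_smul_measure, integral_smul_measure,
    key, key, ENNReal.toReal_ofReal hπ.1.le, ENNReal.toReal_ofReal (sub_pos.2 hπ.2).le]
  · rfl
  · exact (integrable_of_measurable_of_abs_le hF hC).smul_measure ENNReal.ofReal_ne_top
  · exact (integrable_of_measurable_of_abs_le hF hC).smul_measure ENNReal.ofReal_ne_top

/-- The label of a single observation as a real number. -/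
def labelValue (s : Feat D × Fin 2) : ℝ := ((s.2 : ℕ) : ℝ)

theorem measurable_labelValue : Measurable (labelValue (D := D)) :=
  (measurable_of_countable fun b : Fin 2 => ((b : ℕ) : ℝ)).comp measurable_snd

theorem labelValue_mem_Icc (s : Feat D × Fin 2) : labelValue s ∈ Set.Icc (0 : ℝ) 1 :=
  ⟨Nat.cast_nonneg _, by
    have : ((s.2 : ℕ) : ℝ) ≤ 1 := by exact_mod_cast (show (s.2 : ℕ) ≤ 1 by omega)
    exact this⟩

theorem abs_labelValue_sub_le {a : ℝ} (ha : a ∈ Set.Icc (0 : ℝ) 1) (s : Feat D × Fin 2) :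
    |labelValue s - a| ≤ 1 := by
  obtain ⟨h1, h2⟩ := labelValue_mem_Icc s
  rw [abs_le]
  constructor <;> linarith [ha.1, ha.2]

/-- `m(X)` is the conditional mean of `Y` given `X`. -/
theorem integral_mul_labelValue_sub_reg (hπ : 0 < π₁ ∧ π₁ < 1) (M : DensityPair D)
    {F : Feat D → ℝ} (hF : Measurable F) {C : ℝ} (hC : ∀ y, |F y| ≤ C) :
    ∫ s, F s.1 * (labelValue s - M.reg π₁ s.1) ∂(M.joint π₁) = 0 := by
  have hreg := M.measurable_reg π₁
  have hlab := measurable_labelValue (D := D)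
  rw [M.integral_joint hπ (F := fun s => F s.1 * (labelValue s - M.reg π₁ s.1)) (C := C)]
  · simp only [labelValue, Fin.val_one, Fin.val_zero, Nat.cast_one, Nat.cast_zero]
    rw [DensityPair.P₁, DensityPair.P₀,
      integral_withDensity_eq_integral_toReal_smul (by have := M.measurable_f₁; fun_prop)
        (by simp),
      integral_withDensity_eq_integral_toReal_smul (by have := M.measurable_f₀; fun_prop)
        (by simp), ← integral_const_mul, ← integral_const_mul]
    have : ∀ y, π₁ * ((ENNReal.ofReal (M.f₁ y)).toReal • (F y * (1 - M.reg π₁ y)))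
        = - ((1 - π₁) * ((ENNReal.ofReal (M.f₀ y)).toReal • (F y * (0 - M.reg π₁ y)))) := by
      intro y
      rw [ENNReal.toReal_ofReal (M.nonneg_f₀ y), ENNReal.toReal_ofReal (M.nonneg_f₁ y),
        smul_eq_mul, smul_eq_mul]
      linear_combination F y * M.reg_balance hπ y
    simp_rw [this]
    rw [integral_neg, neg_add_cancel]
  · exact (hF.comp measurable_fst).mul (hlab.sub (hreg.comp measurable_fst))
  · intro s
    rw [abs_mul]
    exact (mul_le_of_le_one_right (abs_nonneg _)
      (abs_labelValue_sub_le (M.reg_mem_Icc hπ _) s)).trans (hC _)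

theorem integral_labelValue_sub (hπ : 0 < π₁ ∧ π₁ < 1) (M : DensityPair D) :
    ∫ s, (labelValue s - π₁) ∂(M.joint π₁) = 0 := by
  rw [M.integral_joint hπ (measurable_labelValue.sub_const π₁)
    (abs_labelValue_sub_le ⟨hπ.1.le, hπ.2.le⟩)]
  simp [labelValue]
  ring

theorem lawX_eq_map (M : DensityPair D) (π₁ : ℝ) :
    M.lawX π₁ = (M.joint π₁).map Prod.fst := by
  rw [DensityPair.joint, Measure.map_add _ _ measurable_fst, Measure.map_smul, Measure.map_smul,
    ← Measure.fst, ← Measure.fst, Measure.fst_prod, Measure.fst_prod, DensityPair.lawX]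

theorem joint_fst_notMem_S (M : DensityPair D) (π₁ : ℝ) :
    M.joint π₁ {s | s.1 ∉ M.S} = 0 := by
  have hS : MeasurableSet M.Sᶜ := M.measurableSet_S.compl
  have hzero : ∀ y ∈ M.Sᶜ, M.f₀ y = 0 ∧ M.f₁ y = 0 := by
    intro y hy
    have : ¬ 0 < M.f₀ y + M.f₁ y := hy
    have h0 := M.nonneg_f₀ y
    have h1 := M.nonneg_f₁ y
    constructor <;> linarith
  have h : M.lawX π₁ M.Sᶜ = 0 := by
    have h0 : M.P₀ M.Sᶜ = 0 := by
      rw [DensityPair.P₀, withDensity_apply _ hS, setLIntegral_congr_fun (g := fun _ => 0) hS]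
      · simp
      · intro y hy
        simp [(hzero y hy).1]
    have h1 : M.P₁ M.Sᶜ = 0 := by
      rw [DensityPair.P₁, withDensity_apply _ hS, setLIntegral_congr_fun (g := fun _ => 0) hS]
      · simp
      · intro y hy
        simp [(hzero y hy).2]
    simp [DensityPair.lawX, h0, h1]
  rwa [lawX_eq_map, Measure.map_apply measurable_fst hS] at h

/-- Chebyshev's inequality, conditionally on the features, for the noise `∑ wᵢ (Yᵢ - m(Xᵢ))` of
a linear smoother whose weights have sum of squares at most `q`. -/
theorem measureReal_noise_le (hπ : 0 < π₁ ∧ π₁ < 1) (M : DensityPair D)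
    {w : (Fin n → Feat D) → Fin n → ℝ} (hw : Measurable w) {C q t : ℝ}
    (hC : ∀ X i, |w X i| ≤ C) (hq : ∀ X, ∑ i, w X i ^ 2 ≤ q) (ht : 0 < t) :
    (M.sampleLaw π₁ n).real {z | t ≤ |∑ i, w (fun l => (z l).1) i
      * (labelValue (z i) - M.reg π₁ (z i).1)|} ≤ q / t ^ 2 := by
  have := isProbabilityMeasure_joint hπ M
  have : IsProbabilityMeasure (M.sampleLaw π₁ n) := by
    unfold DensityPair.sampleLaw; infer_instance
  have hfeat : Measurable fun z : Sample D n => fun l => (z l).1 := by fun_prop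
  have hwi : ∀ i, Measurable fun X => w X i := fun i => (measurable_pi_apply i).comp hw
  have hreg := M.measurable_reg π₁
  have hlab := measurable_labelValue (D := D)
  have hres : ∀ s : Feat D × Fin 2, |labelValue s - M.reg π₁ s.1| ≤ 1 := fun s =>
    abs_labelValue_sub_le (M.reg_mem_Icc hπ _) s
  have hVm : ∀ i, Measurable fun z : Sample D n => w (fun l => (z l).1) i
      * (labelValue (z i) - M.reg π₁ (z i).1) := fun i =>
    ((hwi i).comp hfeat).mul ((hlab.sub (hreg.comp measurable_fst)).comp (measurable_pi_apply i))
  have hVb : ∀ i (z : Sample D n), |w (fun l => (z l).1) i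
      * (labelValue (z i) - M.reg π₁ (z i).1)| ≤ C := fun i z => by
    rw [abs_mul]
    exact (mul_le_of_le_one_right (abs_nonneg _) (hres _)).trans (hC _ i)
  refine measureReal_le_abs_sum_le hVm hVb (fun i j hij => ?_) ?_ ht
  · refine integral_pi_eq_zero_of_update (integrable_of_measurable_of_abs_le
      ((hVm i).mul (hVm j)) (C := C * C) fun z => ?_) j fun z => ?_
    · rw [abs_mul]
      exact mul_le_mul (hVb i z) (hVb j z) (abs_nonneg _) ((abs_nonneg _).trans (hVb i z))
    · -- Given all other coordinates, the integrand is a function of `Xⱼ` times `Yⱼ - m(Xⱼ)`.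
      set X : Fin n → Feat D := fun l => (z l).1 with hX
      have hupd : ∀ s : Feat D × Fin 2,
          (fun l => (Function.update z j s l).1) = Function.update X j s.1 := by
        intro s
        funext l
        by_cases h : l = j
        · subst h; simp
        · simp [Function.update_of_ne h, hX]
      simp_rw [hupd, Function.update_of_ne hij, Function.update_self]
      have hup : Measurable fun y : Feat D => Function.update X j y := measurable_update X
      rw [← integral_mul_labelValue_sub_reg hπ M
        (F := fun y => w (Function.update X j y) i * (labelValue (z i) - M.reg π₁ (z i).1)
          * w (Function.update X j y) j)
        ((((hwi i).comp hup).mul_const _).mul ((hwi j).comp hup)) (C := C * C)]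
      · refine integral_congr_ae (Filter.Eventually.of_forall fun s => ?_)
        change _ * _ * (_ * _) = _ * _ * _ * _
        ring
      · intro y
        rw [abs_mul, abs_mul]
        exact mul_le_mul ((mul_le_of_le_one_right (abs_nonneg _) (hres _)).trans (hC _ i))
          (hC _ j) (abs_nonneg _) ((abs_nonneg _).trans (hC X i))
  · have hle : ∀ z : Sample D n, ∑ i, (w (fun l => (z l).1) i
        * (labelValue (z i) - M.reg π₁ (z i).1)) ^ 2 ≤ q := fun z => by
      refine le_trans (Finset.sum_le_sum fun i _ => ?_) (hq fun l => (z l).1)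
      rw [mul_pow]
      refine mul_le_of_le_one_right (sq_nonneg _) ?_
      rw [← sq_abs]
      exact pow_le_one₀ (abs_nonneg _) (hres _)
    have h0 : ∀ z : Sample D n, 0 ≤ ∑ i, (w (fun l => (z l).1) i
        * (labelValue (z i) - M.reg π₁ (z i).1)) ^ 2 := fun z =>
      Finset.sum_nonneg fun i _ => sq_nonneg _
    calc _ ≤ ∫ _ : Sample D n, q ∂(M.sampleLaw π₁ n) :=
          integral_mono_of_nonneg (Filter.Eventually.of_forall h0) (integrable_const q)
            (Filter.Eventually.of_forall hle)
      _ = q := by simp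

end Regression

/-! ### Power of permutation tests based on linear smoothers -/

section Power

variable {D n : ℕ}

/-- The features of a sample. -/
def features (z : Sample D n) : Fin n → Feat D := fun i => (z i).1

theorem measurable_features : Measurable (features : Sample D n → Fin n → Feat D) := by
  unfold features
  fun_prop

/-- The statistic `(∑ wᵢ Yᵢ - π̂₁)²` of a linear smoother whose weights `w` are a function of the
features only. Both the nearest neighbor and the kernel statistic are of this form. -/
noncomputable def linearStat (w : (Fin n → Feat D) → Fin n → ℝ) (z : Sample D n) : ℝ :=
  (∑ i, w (features z) i * label z i - piHat z) ^ 2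

theorem measurable_label (i : Fin n) : Measurable fun z : Sample D n => label z i :=
  measurable_labelValue.comp (measurable_pi_apply i)

theorem measurable_linearStat {w : (Fin n → Feat D) → Fin n → ℝ} (hw : Measurable w) :
    Measurable (linearStat w) := by
  unfold linearStat piHat
  refine ((Finset.measurable_sum _ fun i _ => ?_).sub
    ((Finset.measurable_sum _ fun i _ => measurable_label i).div_const _)).pow_const 2
  exact (((measurable_pi_apply i).comp hw).comp measurable_features).mul (measurable_label i)

theorem label_mem_Icc (z : Sample D n) (i : Fin n) : label z i ∈ Set.Icc (0 : ℝ) 1 :=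
  labelValue_mem_Icc (z i)

theorem natCast_mul_piHat (z : Sample D n) : n * piHat z = ∑ i, label z i := by
  rcases Nat.eq_zero_or_pos n with rfl | hn
  · simp
  · exact mul_div_cancel₀ _ (Nat.cast_pos.2 hn).ne'

theorem piHat_mem_Icc (z : Sample D n) : piHat z ∈ Set.Icc (0 : ℝ) 1 := by
  refine ⟨div_nonneg (Finset.sum_nonneg fun i _ => (label_mem_Icc z i).1) (Nat.cast_nonneg n),
    div_le_one_of_le₀ ?_ (Nat.cast_nonneg n)⟩
  simpa using Finset.sum_le_sum fun i (_ : i ∈ Finset.univ) => (label_mem_Icc z i).2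

theorem piHat_permuteLabels (z : Sample D n) (η : Equiv.Perm (Fin n)) :
    piHat (permuteLabels η z) = piHat z := by
  unfold piHat
  congr 1
  exact Equiv.sum_comp η (label z)

/-- The permutation quantile is at most `q / α` when the weights sum to one and their squares to
at most `q`. -/
theorem permQuantile_linearStat_le {α q : ℝ} (hα : 0 < α ∧ α < 1) (hq : 0 < q)
    {w : (Fin n → Feat D) → Fin n → ℝ} {z : Sample D n}
    (hw : ∀ i, 0 ≤ w (features z) i) (hw1 : ∑ i, w (features z) i = 1)
    (hw2 : ∑ i, w (features z) i ^ 2 ≤ q) :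
    permQuantile α (linearStat w) z ≤ q / α := by
  refine permQuantile_le_of_sum_le (T := linearStat w) z hα (fun z => sq_nonneg _) hq ?_
  set c : Fin n → ℝ := fun i => label z i - piHat z with hc
  have hstat : ∀ η : Equiv.Perm (Fin n), linearStat w (permuteLabels η z)
      = (∑ i, w (features z) i * c (η i)) ^ 2 := by
    intro η
    rw [linearStat, piHat_permuteLabels]
    simp only [hc, mul_sub, Finset.sum_sub_distrib, ← Finset.sum_mul, hw1, one_mul]
    rfl
  have hc0 : ∑ i, c i = 0 := by
    simp only [hc, Finset.sum_sub_distrib, Finset.sum_const, Finset.card_univ, Fintype.card_fin,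
      nsmul_eq_mul, natCast_mul_piHat, sub_self]
  have hc1 : ∀ i, |c i| ≤ 1 := fun i => abs_labelValue_sub_le (piHat_mem_Icc z) (z i)
  rw [Finset.sum_congr rfl fun η _ => hstat η]
  exact (sum_perm_sq_le hc0 hc1 hw).trans (mul_le_mul_of_nonneg_left hw2 permCard_pos.le)

/-- The type II error of the permutation test based on a linear smoother. The weights are
controlled on the event that the ball `B_{x,ε}` holds at least half of the expected number of
sample points guaranteed by the mass condition; `ρ` bounds the bandwidth and `q` the squared
weights, so that `L ρ` and `√q` are the orders of the bias and of the noise of the smoother. -/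
theorem sampleLaw_linearStat_le {π₁ L τ ε₀ δ α β ε ρ q : ℝ} {x : Feat D}
    (hπ : 0 < π₁ ∧ π₁ < 1) (hL : 0 < L) (hτ : 0 < τ) (hα : 0 < α ∧ α < 1) (hβ : 0 < β)
    (hn : 0 < n) (hq : 0 < q) (hε : 0 < ε) (hεε₀ : ε ≤ ε₀)
    {w : (Fin n → Feat D) → Fin n → ℝ} (hw : Measurable w) (hw0 : ∀ X i, 0 ≤ w X i)
    (hw1 : ∀ X i, w X i ≤ 1)
    (hgood : ∀ X, n * (τ * ε ^ D) / 2 ≤ hits (Metric.closedBall x ε) X →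
      ∑ i, w X i = 1 ∧ ∑ i, w X i ^ 2 ≤ q ∧ ∀ i, w X i ≠ 0 → ‖X i - x‖ ≤ ρ)
    (hmass : 4 / (n * (τ * ε ^ D)) ≤ β / 3)
    (hsep : √(q / α) + √(3 * q / β) + √(3 / (n * β)) + L * ρ ≤ √δ)
    {M : DensityPair D} (hM : M ∈ lipAlternatives D π₁ L x τ ε₀ δ) :
    M.sampleLaw π₁ n {z | linearStat w z ≤ permQuantile α (linearStat w) z}
      ≤ ENNReal.ofReal β := by
  obtain ⟨⟨hxS, hball⟩, hlip, hδ⟩ := hM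
  have := isProbabilityMeasure_joint hπ M
  have : IsProbabilityMeasure (M.sampleLaw π₁ n) := by
    unfold DensityPair.sampleLaw; infer_instance
  have hn' : (0 : ℝ) < n := Nat.cast_pos.2 hn
  set μ := M.sampleLaw π₁ n
  set B := Metric.closedBall x ε with hB
  have hBm : MeasurableSet B := Metric.isClosed_closedBall.measurableSet
  set p := τ * ε ^ D with hp_def
  have hp : 0 < p := by positivity
  set G : Set (Fin n → Feat D) := {X | n * p / 2 ≤ hits B X} with hG
  have hGm : MeasurableSet G := measurableSet_le measurable_const (measurable_hits hBm)
  set v : (Fin n → Feat D) → Fin n → ℝ := G.indicator w with hv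
  set t₁ := √(3 * q / β) with ht₁
  set t₂ := √(3 / (n * β)) with ht₂
  have ht₁0 : 0 < t₁ := Real.sqrt_pos.2 (by positivity)
  have ht₂0 : 0 < t₂ := Real.sqrt_pos.2 (by positivity)
  -- Too few points in the ball.
  have hE₁ : μ.real {z | hits (Prod.fst ⁻¹' B) z < n * p / 2} ≤ β / 3 := by
    refine (measureReal_hits_lt_le (μ := M.joint π₁) (measurable_fst hBm) hp ?_ hn).trans hmass
    have h := hball ε hε hεε₀
    rw [lawX_eq_map, Measure.map_apply measurable_fst hBm] at h
    exact (ENNReal.ofReal_le_iff_le_toReal (measure_ne_top _ _)).1 h.le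
  -- Large noise in the smoother.
  have hE₂ : μ.real {z | t₁ ≤ |∑ i, v (fun l => (z l).1) i
      * (labelValue (z i) - M.reg π₁ (z i).1)|} ≤ β / 3 := by
    refine (measureReal_noise_le hπ M (hw.indicator hGm) (C := 1) (q := q) ?_ ?_ ht₁0).trans ?_
    · intro X i
      by_cases hX : X ∈ G
      · rw [Set.indicator_of_mem hX, abs_of_nonneg (hw0 X i)]
        exact hw1 X i
      · rw [Set.indicator_of_notMem hX]
        simp
    · intro X
      by_cases hX : X ∈ G
      · rw [Set.indicator_of_mem hX]
        exact (hgood X hX).2.1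
      · rw [Set.indicator_of_notMem hX]
        simpa using hq.le
    · rw [ht₁, Real.sq_sqrt (by positivity)]
      exact le_of_eq (by field_simp)
  -- Large error of the empirical class probability.
  have hE₃ : μ.real {z | n * t₂ ≤ |∑ i, (labelValue (z i) - π₁)|} ≤ β / 3 := by
    have habs := abs_labelValue_sub_le (D := D) (a := π₁) ⟨hπ.1.le, hπ.2.le⟩
    refine (measureReal_pi_le_abs_sum_le (μ := M.joint π₁) (u := fun s => labelValue s - π₁)
      (q := 1) (measurable_labelValue.sub_const π₁) habs (integral_labelValue_sub hπ M) ?_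
      (mul_pos hn' ht₂0)).trans ?_
    · calc _ ≤ ∫ _ : Feat D × Fin 2, (1 : ℝ) ∂(M.joint π₁) :=
          integral_mono_of_nonneg (Filter.Eventually.of_forall fun s => sq_nonneg _)
            (integrable_const 1) (Filter.Eventually.of_forall fun s => by
              change (labelValue s - π₁) ^ 2 ≤ 1
              rw [← sq_abs]
              exact pow_le_one₀ (abs_nonneg _) (habs s))
        _ = 1 := by simp
    · rw [mul_pow, ht₂, Real.sq_sqrt (by positivity)]
      exact le_of_eq (by field_simp)
  have hE₄ : μ.real {z | ∃ i, (z i).1 ∉ M.S} = 0 := by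
    have h : μ {z | ∃ i, (z i).1 ∉ M.S} = 0 := by
      rw [Set.ofPred_exists]
      refine measure_iUnion_null fun i => ?_
      have hmp := measurePreserving_eval (fun _ : Fin n => M.joint π₁) i
      exact hmp.quasiMeasurePreserving.preimage_null (joint_fst_notMem_S M π₁)
    simp [Measure.real, h]
  have hcover : {z | linearStat w z ≤ permQuantile α (linearStat w) z} ⊆
      (({z | hits (Prod.fst ⁻¹' B) z < n * p / 2} ∪
        {z | t₁ ≤ |∑ i, v (fun l => (z l).1) i * (labelValue (z i) - M.reg π₁ (z i).1)|}) ∪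
        {z | n * t₂ ≤ |∑ i, (labelValue (z i) - π₁)|}) ∪ {z | ∃ i, (z i).1 ∉ M.S} := by
    intro z hz
    by_contra hcon
    simp only [Set.mem_union, Set.mem_ofPred_eq, not_or, not_lt, not_le, not_exists,
      not_not] at hcon
    obtain ⟨⟨⟨h1, h2⟩, h3⟩, h4⟩ := hcon
    have hX : features z ∈ G := h1
    obtain ⟨hsum, hsq, hsupp⟩ := hgood _ hX
    have hv' : v (fun l => (z l).1) = w (features z) := Set.indicator_of_mem hX w
    rw [hv'] at h2
    -- The bias of the smoother.
    have hbias : |∑ i, w (features z) i * M.reg π₁ (z i).1 - M.reg π₁ x| ≤ L * ρ := by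
      have e : ∑ i, w (features z) i * M.reg π₁ (z i).1 - M.reg π₁ x
          = ∑ i, w (features z) i * (M.reg π₁ (z i).1 - M.reg π₁ x) := by
        simp only [mul_sub, Finset.sum_sub_distrib, ← Finset.sum_mul, hsum, one_mul]
      rw [e]
      calc _ ≤ ∑ i, |w (features z) i * (M.reg π₁ (z i).1 - M.reg π₁ x)| :=
            Finset.abs_sum_le_sum_abs _ _
        _ ≤ ∑ i, w (features z) i * (L * ρ) := by
            refine Finset.sum_le_sum fun i _ => ?_
            rw [abs_mul, abs_of_nonneg (hw0 _ i)]
            by_cases hi : w (features z) i = 0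
            · rw [hi, zero_mul, zero_mul]
            · exact mul_le_mul_of_nonneg_left ((hlip _ (h4 i) _ hxS).trans
                (mul_le_mul_of_nonneg_left (hsupp i hi) hL.le)) (hw0 _ i)
        _ = L * ρ := by rw [← Finset.sum_mul, hsum, one_mul]
    have hpi : |piHat z - π₁| < t₂ := by
      have e : ∑ i, (labelValue (z i) - π₁) = n * (piHat z - π₁) := by
        rw [mul_sub, natCast_mul_piHat, Finset.sum_sub_distrib, Finset.sum_const,
          Finset.card_univ, Fintype.card_fin, nsmul_eq_mul]
        rfl
      rw [e, abs_mul, abs_of_pos hn'] at h3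
      exact lt_of_mul_lt_mul_left h3 hn'.le
    have hdec : ∑ i, w (features z) i * label z i - piHat z
        = ∑ i, w (features z) i * (labelValue (z i) - M.reg π₁ (z i).1)
          + (∑ i, w (features z) i * M.reg π₁ (z i).1 - M.reg π₁ x)
          - (piHat z - π₁) + (M.reg π₁ x - π₁) := by
      have e : ∑ i, w (features z) i * (labelValue (z i) - M.reg π₁ (z i).1)
          = ∑ i, w (features z) i * label z i - ∑ i, w (features z) i * M.reg π₁ (z i).1 := by
        simp only [mul_sub, Finset.sum_sub_distrib]
        rfl
      rw [e]
      ring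
    have hsig : √δ ≤ |M.reg π₁ x - π₁| := by
      rw [← Real.sqrt_sq_eq_abs]
      exact Real.sqrt_le_sqrt hδ
    have hlow : √(q / α) < |∑ i, w (features z) i * label z i - piHat z| := by
      set A := ∑ i, w (features z) i * (labelValue (z i) - M.reg π₁ (z i).1)
      set b := ∑ i, w (features z) i * M.reg π₁ (z i).1 - M.reg π₁ x
      have h5 : |M.reg π₁ x - π₁| ≤ |∑ i, w (features z) i * label z i - piHat z|
          + |A| + |b| + |piHat z - π₁| := by
        have e : M.reg π₁ x - π₁ = (∑ i, w (features z) i * label z i - piHat z)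
            + -A + -b + (piHat z - π₁) := by rw [hdec]; ring
        rw [e, ← abs_neg A, ← abs_neg b]
        exact (abs_add_le _ _).trans (add_le_add ((abs_add_le _ _).trans
          (add_le_add (abs_add_le _ _) le_rfl)) le_rfl)
      linarith
    have hT : q / α < linearStat w z := by
      have h6 := (Real.sqrt_lt' ((Real.sqrt_nonneg _).trans_lt hlow)).1 hlow
      rwa [sq_abs] at h6
    have hquant := permQuantile_linearStat_le hα hq (hw0 _) hsum hsq
    exact absurd hz (not_le.2 (hquant.trans_lt hT))
  have hreal : μ.real {z | linearStat w z ≤ permQuantile α (linearStat w) z} ≤ β := by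
    refine (measureReal_mono hcover).trans ?_
    refine (measureReal_union_le _ _).trans ?_
    rw [hE₄, add_zero]
    refine (measureReal_union_le _ _).trans ?_
    have := measureReal_union_le (μ := μ) {z | hits (Prod.fst ⁻¹' B) z < n * p / 2}
      {z | t₁ ≤ |∑ i, v (fun l => (z l).1) i * (labelValue (z i) - M.reg π₁ (z i).1)|}
    linarith
  exact (ENNReal.le_ofReal_iff_toReal_le (measure_ne_top _ _) hβ.le).2 hreal

end Power

/-! ### Nearest neighbor weights -/

section NearestNeighbor

variable {D n : ℕ}

/-- `neighborRank` as a function of the features alone. -/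
noncomputable def featureRank (x : Feat D) (X : Fin n → Feat D) (i : Fin n) : ℕ :=
  (Finset.univ.filter fun j : Fin n =>
    ‖X j - x‖ < ‖X i - x‖ ∨ (‖X j - x‖ = ‖X i - x‖ ∧ j < i)).card

theorem featureRank_lt_featureRank (x : Feat D) (X : Fin n → Feat D) {i j : Fin n}
    (h : toLex (‖X i - x‖, i) < toLex (‖X j - x‖, j)) :
    featureRank x X i < featureRank x X j := by
  refine Finset.card_lt_card (Finset.ssubset_iff_of_subset ?_ |>.2 ⟨i, ?_, ?_⟩)
  · intro l hl
    rw [Finset.mem_filter_univ] at hl ⊢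
    have hl' : toLex (‖X l - x‖, l) < toLex (‖X i - x‖, i) := Prod.Lex.toLex_lt_toLex.2 hl
    exact Prod.Lex.toLex_lt_toLex.1 (hl'.trans h)
  · rw [Finset.mem_filter_univ]
    exact Prod.Lex.toLex_lt_toLex.1 h
  · simp

theorem featureRank_injective (x : Feat D) (X : Fin n → Feat D) :
    Function.Injective (featureRank x X) := by
  intro i j hij
  rcases lt_trichotomy (toLex (‖X i - x‖, i)) (toLex (‖X j - x‖, j)) with h | h | h
  · exact absurd hij (featureRank_lt_featureRank x X h).ne
  · exact congrArg Prod.snd (toLex.injective h)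
  · exact absurd hij (featureRank_lt_featureRank x X h).ne'

theorem featureRank_lt (x : Feat D) (X : Fin n → Feat D) (i : Fin n) : featureRank x X i < n := by
  refine (Finset.card_lt_card (Finset.ssubset_univ_iff.2 fun h => ?_)).trans_eq
    ((Finset.card_univ).trans (Fintype.card_fin n))
  have := h ▸ Finset.mem_univ i
  simp at this

/-- There are exactly `k` sample points among the `k` nearest neighbors. -/
theorem card_featureRank_lt (x : Feat D) (X : Fin n → Feat D) {k : ℕ} (hk : k ≤ n) :
    (Finset.univ.filter fun i : Fin n => featureRank x X i < k).card = k := by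
  have himage : Finset.univ.image (featureRank x X) = Finset.range n := by
    refine Finset.eq_of_subset_of_card_le (fun m hm => ?_) ?_
    · obtain ⟨i, -, rfl⟩ := Finset.mem_image.1 hm
      exact Finset.mem_range.2 (featureRank_lt x X i)
    · rw [Finset.card_image_of_injective _ (featureRank_injective x X)]
      simp
  have : (Finset.univ.filter fun i : Fin n => featureRank x X i < k).image (featureRank x X)
      = Finset.range k := by
    ext m
    simp only [Finset.mem_image, Finset.mem_filter_univ, Finset.mem_range]
    refine ⟨fun ⟨i, hi, him⟩ => him ▸ hi, fun hm => ?_⟩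
    have : m ∈ Finset.univ.image (featureRank x X) := by
      rw [himage]
      exact Finset.mem_range.2 (hm.trans_le hk)
    obtain ⟨i, -, rfl⟩ := Finset.mem_image.1 this
    exact ⟨i, hm, rfl⟩
  rw [← Finset.card_image_of_injective _ (featureRank_injective x X), this, Finset.card_range]

theorem hits_eq_card {E : Type*} [MeasurableSpace E] (B : Set E) [DecidablePred (· ∈ B)]
    (X : Fin n → E) : hits B X = ((Finset.univ.filter fun i => X i ∈ B).card : ℝ) := by
  rw [hits, ← Finset.sum_boole]
  exact Finset.sum_congr rfl fun i _ => Set.indicator_apply _ _ _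

/-- The `k` nearest neighbors lie in every ball that holds at least `k` sample points. -/
theorem norm_sub_le_of_featureRank_lt {x : Feat D} {X : Fin n → Feat D} {k : ℕ} {ε : ℝ}
    (hk : (k : ℝ) ≤ hits (Metric.closedBall x ε) X) {i : Fin n} (hi : featureRank x X i < k) :
    ‖X i - x‖ ≤ ε := by
  classical
  by_contra! hlt
  rw [hits_eq_card, Nat.cast_le] at hk
  refine absurd (hk.trans (Finset.card_le_card fun j hj => ?_)) (not_le.2 hi)
  rw [Finset.mem_filter_univ] at hj ⊢
  rw [Metric.mem_closedBall, dist_eq_norm] at hj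
  exact Or.inl (hj.trans_lt hlt)

/-- The weights of the nearest neighbor estimator. -/
noncomputable def knnWeight (k : ℕ) (x : Feat D) (X : Fin n → Feat D) (i : Fin n) : ℝ :=
  if featureRank x X i < k then (k : ℝ)⁻¹ else 0

theorem knnStat_eq_linearStat (k : ℕ) (x : Feat D) :
    (knnStat k x : Sample D n → ℝ) = linearStat (knnWeight k x) := by
  funext z
  unfold knnStat linearStat knnEstimator
  congr 2
  rw [Finset.sum_filter, Finset.sum_div]
  refine Finset.sum_congr rfl fun i _ => ?_
  change (if featureRank x (features z) i < k then label z i else 0) / (k : ℝ) = _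
  unfold knnWeight
  split_ifs <;> simp [div_eq_inv_mul]

theorem measurable_featureRank (x : Feat D) (i : Fin n) :
    Measurable fun X : Fin n → Feat D => featureRank x X i := by
  have hd : ∀ j, Measurable fun X : Fin n → Feat D => ‖X j - x‖ := fun j => by
    fun_prop
  simp_rw [featureRank, Finset.card_filter]
  refine Finset.measurable_sum _ fun j _ => ?_
  have hset : MeasurableSet ({X : Fin n → Feat D | ‖X j - x‖ < ‖X i - x‖} ∪
      ({X : Fin n → Feat D | ‖X j - x‖ = ‖X i - x‖} ∩ {_X : Fin n → Feat D | j < i})) :=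
    (measurableSet_lt (hd j) (hd i)).union
      ((measurableSet_eq_fun (hd j) (hd i)).inter (.const _))
  exact Measurable.ite hset measurable_const measurable_const

theorem measurable_knnWeight (k : ℕ) (x : Feat D) :
    Measurable (knnWeight k x : (Fin n → Feat D) → Fin n → ℝ) := by
  refine measurable_pi_lambda _ fun i => ?_
  exact Measurable.ite (measurableSet_lt (measurable_featureRank x i) measurable_const)
    measurable_const measurable_const

theorem knnWeight_mem_Icc (k : ℕ) (x : Feat D) (X : Fin n → Feat D) (i : Fin n) :
    knnWeight k x X i ∈ Set.Icc (0 : ℝ) 1 := by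
  unfold knnWeight
  split_ifs
  · exact ⟨by positivity, Nat.cast_inv_le_one k⟩
  · simp

theorem sum_knnWeight {k : ℕ} (hk0 : 0 < k) (hk : k ≤ n) (x : Feat D) (X : Fin n → Feat D) :
    ∑ i, knnWeight k x X i = 1 := by
  have : (k : ℝ) ≠ 0 := (Nat.cast_pos.2 hk0).ne'
  simp_rw [knnWeight]
  rw [← Finset.sum_filter, Finset.sum_const, card_featureRank_lt x X hk, nsmul_eq_mul,
    mul_inv_cancel₀ this]

theorem sum_knnWeight_sq {k : ℕ} (hk0 : 0 < k) (hk : k ≤ n) (x : Feat D) (X : Fin n → Feat D) :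
    ∑ i, knnWeight k x X i ^ 2 = (k : ℝ)⁻¹ := by
  have h : ∀ i, knnWeight k x X i ^ 2 = knnWeight k x X i * (k : ℝ)⁻¹ := by
    intro i
    unfold knnWeight
    split_ifs <;> simp [sq]
  rw [Finset.sum_congr rfl fun i _ => h i, ← Finset.sum_mul, sum_knnWeight hk0 hk, one_mul]

end NearestNeighbor

/-! ### Kernel weights -/

section Kernel

variable {D n : ℕ} {lam r R : ℝ} {K : Feat D → ℝ}

/-- The weights of the kernel estimator. -/
noncomputable def kernelWeight (K : Feat D → ℝ) (h : ℝ) (x : Feat D) (X : Fin n → Feat D)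
    (i : Fin n) : ℝ :=
  K (h⁻¹ • (x - X i)) / ∑ j, K (h⁻¹ • (x - X j))

theorem kernelStat_eq_linearStat (K : Feat D → ℝ) (h : ℝ) (x : Feat D) :
    (kernelStat K h x : Sample D n → ℝ) = linearStat (kernelWeight K h x) := by
  funext z
  unfold kernelStat linearStat kernelEstimator
  congr 2
  rw [Finset.sum_div]
  refine Finset.sum_congr rfl fun i _ => ?_
  change _ = K (h⁻¹ • (x - (z i).1)) / (∑ j, K (h⁻¹ • (x - (z j).1))) * label z i
  ring

theorem measurable_kernelWeight (hK : K ∈ kernelClass D lam r R) (h : ℝ) (x : Feat D) :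
    Measurable (kernelWeight K h x : (Fin n → Feat D) → Fin n → ℝ) := by
  have hKm := hK.1
  refine measurable_pi_lambda _ fun i => ?_
  unfold kernelWeight
  fun_prop

theorem kernel_nonneg (hlam : 0 < lam) (hK : K ∈ kernelClass D lam r R) (u : Feat D) : 0 ≤ K u :=
  (mul_nonneg hlam.le (Set.indicator_nonneg (fun _ _ => zero_le_one) _)).trans (hK.2 u).1

theorem kernel_le_one (hK : K ∈ kernelClass D lam r R) (u : Feat D) : K u ≤ 1 :=
  (hK.2 u).2.trans (Set.indicator_le' (fun _ _ => le_rfl) (fun _ _ => zero_le_one) u)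

theorem norm_le_of_kernel_ne_zero (hlam : 0 < lam) (hK : K ∈ kernelClass D lam r R) {u : Feat D}
    (hu : K u ≠ 0) : ‖u‖ ≤ R := by
  by_contra hR
  refine hu (le_antisymm ?_ (kernel_nonneg hlam hK u))
  have h := (hK.2 u).2
  rwa [Set.indicator_of_notMem (by simpa using hR)] at h

theorem kernelWeight_mem_Icc (hlam : 0 < lam) (hK : K ∈ kernelClass D lam r R) (h : ℝ)
    (x : Feat D) (X : Fin n → Feat D) (i : Fin n) :
    kernelWeight K h x X i ∈ Set.Icc (0 : ℝ) 1 := by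
  have h0 := fun j => kernel_nonneg hlam hK (h⁻¹ • (x - X j))
  exact ⟨div_nonneg (h0 i) (Finset.sum_nonneg fun j _ => h0 j),
    div_le_one_of_le₀ (Finset.single_le_sum (fun j _ => h0 j) (Finset.mem_univ i))
      (Finset.sum_nonneg fun j _ => h0 j)⟩

theorem mul_hits_le_sum_kernel (hK : K ∈ kernelClass D lam r R) {h : ℝ}
    (hh : 0 < h) (x : Feat D) (X : Fin n → Feat D) :
    lam * hits (Metric.closedBall x (r * h)) X ≤ ∑ j, K (h⁻¹ • (x - X j)) := by
  rw [hits, Finset.mul_sum]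
  refine Finset.sum_le_sum fun j _ => le_of_eq_of_le ?_ (hK.2 _).1
  congr 1
  refine Set.indicator_eq_indicator ?_ rfl
  rw [Metric.mem_closedBall, mem_closedBall_zero_iff, norm_smul, norm_inv, Real.norm_of_nonneg hh.le,
    dist_comm, dist_eq_norm, inv_mul_le_iff₀ hh, mul_comm r h]

theorem sum_kernelWeight {h : ℝ} {x : Feat D} {X : Fin n → Feat D}
    (hpos : 0 < ∑ j, K (h⁻¹ • (x - X j))) : ∑ i, kernelWeight K h x X i = 1 := by
  unfold kernelWeight
  rw [← Finset.sum_div, div_self hpos.ne']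

theorem sum_kernelWeight_sq_le (hlam : 0 < lam) (hK : K ∈ kernelClass D lam r R) {h : ℝ}
    {x : Feat D} {X : Fin n → Feat D} (hpos : 0 < ∑ j, K (h⁻¹ • (x - X j))) :
    ∑ i, kernelWeight K h x X i ^ 2 ≤ (∑ j, K (h⁻¹ • (x - X j)))⁻¹ := by
  calc _ ≤ ∑ i, kernelWeight K h x X i * (∑ j, K (h⁻¹ • (x - X j)))⁻¹ := by
        refine Finset.sum_le_sum fun i _ => ?_
        rw [sq]
        refine mul_le_mul_of_nonneg_left ?_ (kernelWeight_mem_Icc hlam hK h x X i).1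
        rw [kernelWeight, div_eq_mul_inv]
        exact mul_le_of_le_one_left (inv_nonneg.2 hpos.le) (kernel_le_one hK _)
    _ = _ := by rw [← Finset.sum_mul, sum_kernelWeight hpos, one_mul]

theorem norm_sub_le_of_kernelWeight_ne_zero (hlam : 0 < lam) (hK : K ∈ kernelClass D lam r R)
    {h : ℝ} (hh : 0 < h) {x : Feat D} {X : Fin n → Feat D} {i : Fin n}
    (hi : kernelWeight K h x X i ≠ 0) : ‖X i - x‖ ≤ R * h := by
  have h1 := norm_le_of_kernel_ne_zero hlam hK (fun h0 => hi (by rw [kernelWeight, h0, zero_div]))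
  rwa [norm_smul, norm_inv, Real.norm_of_nonneg hh.le, inv_mul_le_iff₀ hh, norm_sub_rev,
    mul_comm] at h1

end Kernel

/-! ### The rate of separation -/

section Rate

variable {D n : ℕ}

/-- The bandwidth `n^(-1/(2+D))` at which the bias and the noise of the smoothers balance. -/
noncomputable def bandwidth (D n : ℕ) : ℝ := (n : ℝ) ^ (-(1 / (2 + (D : ℝ))))

theorem bandwidth_pos (hn : 0 < n) : 0 < bandwidth D n :=
  Real.rpow_pos_of_pos (Nat.cast_pos.2 hn) _

theorem bandwidth_le_one (hn : 0 < n) : bandwidth D n ≤ 1 :=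
  Real.rpow_le_one_of_one_le_of_nonpos (Nat.one_le_cast.2 hn) (neg_nonpos.2 (by positivity))

theorem bandwidth_sq : bandwidth D n ^ 2 = (n : ℝ) ^ (-(2 / (2 + (D : ℝ)))) := by
  rw [bandwidth, ← Real.rpow_natCast, ← Real.rpow_mul (Nat.cast_nonneg n)]
  congr 1
  push_cast
  ring

theorem bandwidth_sq_inv : (bandwidth D n ^ 2)⁻¹ = (n : ℝ) ^ (2 / (2 + (D : ℝ))) := by
  rw [bandwidth_sq, Real.rpow_neg (Nat.cast_nonneg n), inv_inv]

/-- The expected number of sample points in a ball whose radius is the bandwidth has the order of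
the inverse squared bandwidth. -/
theorem mul_bandwidth_pow (hn : 0 < n) : n * bandwidth D n ^ D = (bandwidth D n ^ 2)⁻¹ := by
  have hn' : (0 : ℝ) < n := Nat.cast_pos.2 hn
  have h : bandwidth D n ^ (2 + D) = (n : ℝ)⁻¹ := by
    rw [bandwidth, ← Real.rpow_natCast, ← Real.rpow_mul hn'.le, ← Real.rpow_neg_one]
    congr 1
    have : (2 : ℝ) + D ≠ 0 := by positivity
    push_cast
    field_simp
  refine eq_inv_of_mul_eq_one_left ?_
  rw [mul_assoc, ← pow_add, add_comm D 2, h,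
    mul_inv_cancel₀ hn'.ne']

theorem inv_le_bandwidth_sq (hn : 0 < n) : (n : ℝ)⁻¹ ≤ bandwidth D n ^ 2 := by
  have hn' : (0 : ℝ) < n := Nat.cast_pos.2 hn
  have hb := bandwidth_pos (D := D) hn
  rw [inv_le_comm₀ hn' (by positivity), ← mul_bandwidth_pow hn]
  exact mul_le_of_le_one_right hn'.le (pow_le_one₀ hb.le (bandwidth_le_one hn))

theorem exists_bandwidth_le (D : ℕ) {η : ℝ} (hη : 0 < η) :
    ∃ N : ℕ, 0 < N ∧ ∀ n, N ≤ n → bandwidth D n ≤ η := by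
  have h : Filter.Tendsto (fun n : ℕ => bandwidth D n) Filter.atTop (nhds 0) :=
    (tendsto_rpow_neg_atTop (by positivity)).comp tendsto_natCast_atTop_atTop
  obtain ⟨N, hN⟩ := Filter.eventually_atTop.1 (h.eventually_le_const hη)
  exact ⟨N + 1, N.succ_pos, fun n hn => hN n (by omega)⟩

/-- Type II errors of smoothers with bandwidth, squared weights and local counts of the orders
`n^(-1/(2+D))`, `n^(-2/(2+D))` and `n^(2/(2+D))`: with these orders all of the terms that the signal
`|m(x) - π₁|` has to exceed are multiples of the bandwidth. -/
theorem exists_worstProb_linearStat_le (D : ℕ) {π₁ L τ ε₀ α β c q ρ : ℝ} (x : Feat D)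
    (hπ : 0 < π₁ ∧ π₁ < 1) (hL : 0 < L) (hτ : 0 < τ) (hε₀ : 0 < ε₀) (hα : 0 < α ∧ α < 1)
    (hβ : 0 < β) (hc : 0 < c) (hq : 0 < q) (hρ : 0 < ρ) :
    ∃ C : ℝ, ∃ N : ℕ, 0 < C ∧ 0 < N ∧ ∀ n, N ≤ n → ∀ w : (Fin n → Feat D) → Fin n → ℝ,
      Measurable w → (∀ X i, w X i ∈ Set.Icc (0 : ℝ) 1) →
      (∀ X, τ * c ^ D / 2 * (bandwidth D n ^ 2)⁻¹
          ≤ hits (Metric.closedBall x (c * bandwidth D n)) X →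
        ∑ i, w X i = 1 ∧ ∑ i, w X i ^ 2 ≤ q * bandwidth D n ^ 2 ∧
          ∀ i, w X i ≠ 0 → ‖X i - x‖ ≤ ρ * bandwidth D n) →
      worstProb π₁ (lipAlternatives D π₁ L x τ ε₀ (C * (n : ℝ) ^ (-(2 / (2 + (D : ℝ))))))
        {z : Sample D n | linearStat w z ≤ permQuantile α (linearStat w) z}
        ≤ ENNReal.ofReal β := by
  obtain ⟨N, hN0, hN⟩ := exists_bandwidth_le D (η := min (ε₀ / c) (β / 3 * (τ * c ^ D / 4)))
    (by have := hα.1; positivity)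
  have hα0 := hα.1
  set A := √(q / α) + √(3 * q / β) + √(3 / β) + L * ρ with hA
  have hA0 : 0 < A := by positivity
  refine ⟨A ^ 2, N, by positivity, hN0, fun n hn w hw hw01 hgood => iSup₂_le fun M hM => ?_⟩
  have hn0 : 0 < n := hN0.trans_le hn
  have hn' : (0 : ℝ) < n := Nat.cast_pos.2 hn0
  set b := bandwidth D n with hb_def
  have hb : 0 < b := bandwidth_pos hn0
  have hb1 : b ≤ 1 := bandwidth_le_one hn0
  have hbN := hN n hn
  have hnp : n * (τ * (c * b) ^ D) = τ * c ^ D * (b ^ 2)⁻¹ := by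
    rw [← mul_bandwidth_pow hn0, mul_pow]
    ring
  rw [← bandwidth_sq] at hM
  refine sampleLaw_linearStat_le (ε := c * b) (ρ := ρ * b) (q := q * b ^ 2) hπ hL hτ hα hβ hn0
    (by positivity) (by positivity) ?_ hw (fun X i => (hw01 X i).1) (fun X i => (hw01 X i).2)
    (fun X hX => hgood X ?_) ?_ ?_ hM
  · have := hbN.trans (min_le_left _ _)
    rwa [le_div_iff₀ hc, mul_comm] at this
  · rw [hnp] at hX
    linarith
  · have h1 : b ^ 2 ≤ β / 3 * (τ * c ^ D / 4) := by
      refine le_trans ?_ (hbN.trans (min_le_right _ _))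
      nlinarith
    rw [hnp, div_le_iff₀ (by positivity)]
    have h2 := mul_le_mul_of_nonneg_right h1 (inv_nonneg.2 (sq_nonneg b))
    rw [mul_inv_cancel₀ (by positivity)] at h2
    linarith
  · have e1 : √(q * b ^ 2 / α) = √(q / α) * b := by
      rw [show q * b ^ 2 / α = q / α * b ^ 2 by ring, Real.sqrt_mul (by positivity),
        Real.sqrt_sq hb.le]
    have e2 : √(3 * (q * b ^ 2) / β) = √(3 * q / β) * b := by
      rw [show 3 * (q * b ^ 2) / β = 3 * q / β * b ^ 2 by ring, Real.sqrt_mul (by positivity),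
        Real.sqrt_sq hb.le]
    have e3 : √(3 / (n * β)) ≤ √(3 / β) * b := by
      rw [← Real.sqrt_sq hb.le, ← Real.sqrt_mul (by positivity)]
      refine Real.sqrt_le_sqrt ?_
      rw [show 3 / (n * β) = 3 / β * (n : ℝ)⁻¹ by field_simp]
      exact mul_le_mul_of_nonneg_left (inv_le_bandwidth_sq hn0) (by positivity)
    have e4 : √(A ^ 2 * b ^ 2) = A * b := by
      rw [← mul_pow, Real.sqrt_sq (by positivity)]
    change _ ≤ √(A ^ 2 * b ^ 2)
    rw [e1, e2, e4, hA]
    linarith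

/-- Power of the nearest neighbor test, with squared weights `1 / k ≤ 2 n^(-2/(2+D))`. -/
theorem exists_knn_power (D : ℕ) (hD : 0 < D) {π₁ L τ ε₀ α β : ℝ} (x : Feat D)
    (hπ : 0 < π₁ ∧ π₁ < 1) (hL : 0 < L) (hτ : 0 < τ) (hε₀ : 0 < ε₀) (hα : 0 < α ∧ α < 1)
    (hβ : 0 < β) :
    ∃ C : ℝ, ∃ N : ℕ, 0 < C ∧ 0 < N ∧ ∀ n k : ℕ, N ≤ n →
      |(k : ℝ) - (n : ℝ) ^ (2 / (2 + (D : ℝ)))| < 1 →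
      worstProb π₁ (lipAlternatives D π₁ L x τ ε₀ (C * (n : ℝ) ^ (-(2 / (2 + (D : ℝ))))))
        {z : Sample D n | knnStat k x z ≤ permQuantile α (knnStat k x) z}
        ≤ ENNReal.ofReal β := by
  -- The radius is such that the ball is expected to hold at least `4 n^(2/(2+D))` sample points.
  set c := max 1 (4 / τ) with hc_def
  have hc1 : 1 ≤ c := le_max_left _ _
  have hc0 : 0 < c := one_pos.trans_le hc1
  have hcD : 2 ≤ τ * c ^ D / 2 := by
    have h1 : 4 / τ ≤ c ^ D := (le_max_right _ _).trans (le_self_pow₀ hc1 hD.ne')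
    rw [div_le_iff₀ hτ] at h1
    linarith
  obtain ⟨C, N, hC, hN, h⟩ := exists_worstProb_linearStat_le D (c := c) (q := 2) (ρ := c) x
    hπ hL hτ hε₀ hα hβ hc0 two_pos hc0
  refine ⟨C, N, hC, hN, fun n k hn hk => ?_⟩
  have hn0 : 0 < n := hN.trans_le hn
  rw [← bandwidth_sq_inv, abs_lt] at hk
  rw [knnStat_eq_linearStat]
  refine h n hn _ (measurable_knnWeight k x) (knnWeight_mem_Icc k x) fun X hX => ?_
  set b := bandwidth D n
  have hb : 0 < b := bandwidth_pos hn0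
  have hb1 : 1 ≤ (b ^ 2)⁻¹ :=
    (one_le_inv₀ (by positivity)).2 (pow_le_one₀ hb.le (bandwidth_le_one hn0))
  have hk0 : 0 < k := by
    have : (0 : ℝ) < k := by linarith
    exact_mod_cast this
  have hk1 : (1 : ℝ) ≤ k := Nat.one_le_cast.2 hk0
  have hkX : (k : ℝ) ≤ hits (Metric.closedBall x (c * b)) X := by
    refine le_trans ?_ hX
    nlinarith
  have hkn : k ≤ n := by
    classical
    rw [hits_eq_card, Nat.cast_le] at hkX
    exact hkX.trans ((Finset.card_le_univ _).trans_eq (Fintype.card_fin n))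
  refine ⟨sum_knnWeight hk0 hkn x X, ?_, fun i hi => ?_⟩
  · rw [sum_knnWeight_sq hk0 hkn, inv_le_iff_one_le_mul₀ (by linarith)]
    have h1 : (b ^ 2)⁻¹ ≤ 2 * k := by linarith
    rw [inv_le_iff_one_le_mul₀ (by positivity)] at h1
    linarith
  · refine norm_sub_le_of_featureRank_lt hkX ?_
    by_contra hlt
    exact hi (if_neg hlt)

/-- Power of the kernel test. The normalizing sum of the kernel is at least `lam` times the number
of sample points in the ball of radius `r h`, which bounds the squared weights. -/
theorem exists_kernel_power (D : ℕ) {π₁ L τ ε₀ α β lam r R : ℝ} (x : Feat D)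
    (hπ : 0 < π₁ ∧ π₁ < 1) (hL : 0 < L) (hτ : 0 < τ) (hε₀ : 0 < ε₀) (hα : 0 < α ∧ α < 1)
    (hβ : 0 < β) (hlam : 0 < lam) (hr : 0 < r) (hrR : r < R) :
    ∃ C : ℝ, ∃ N : ℕ, 0 < C ∧ 0 < N ∧ ∀ K ∈ kernelClass D lam r R, ∀ n : ℕ, N ≤ n →
      worstProb π₁ (lipAlternatives D π₁ L x τ ε₀ (C * (n : ℝ) ^ (-(2 / (2 + (D : ℝ))))))
        {z : Sample D n | kernelStat K (bandwidth D n) x z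
          ≤ permQuantile α (kernelStat K (bandwidth D n) x) z}
        ≤ ENNReal.ofReal β := by
  obtain ⟨C, N, hC, hN, h⟩ := exists_worstProb_linearStat_le D (c := r)
    (q := (lam * (τ * r ^ D / 2))⁻¹) (ρ := R) x hπ hL hτ hε₀ hα hβ hr (by positivity)
    (hr.trans hrR)
  refine ⟨C, N, hC, hN, fun K hK n hn => ?_⟩
  have hb : 0 < bandwidth D n := bandwidth_pos (hN.trans_le hn)
  rw [kernelStat_eq_linearStat]
  refine h n hn _ (measurable_kernelWeight hK _ x) (kernelWeight_mem_Icc hlam hK _ x)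
    fun X hX => ?_
  set b := bandwidth D n
  have hsum : lam * (τ * r ^ D / 2 * (b ^ 2)⁻¹) ≤ ∑ j, K (b⁻¹ • (x - X j)) :=
    (mul_le_mul_of_nonneg_left hX hlam.le).trans (mul_hits_le_sum_kernel hK hb x X)
  have hlow : 0 < lam * (τ * r ^ D / 2 * (b ^ 2)⁻¹) := by positivity
  have hpos := hlow.trans_le hsum
  refine ⟨sum_kernelWeight hpos, (sum_kernelWeight_sq_le hlam hK hpos).trans ?_, fun i hi =>
    norm_sub_le_of_kernelWeight_ne_zero hlam hK hb hi⟩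
  refine (inv_anti₀ hlow hsum).trans_eq ?_
  rw [← mul_assoc, mul_inv, inv_inv]

end Rate

/-! ### Minimum separation -/

section Separation

variable {D n : ℕ} {π₁ L τ ε₀ α β : ℝ} {x : Feat D}

/-- A permutation test as an element of the class of level `α` tests. -/
theorem permTest_mem_levelTests (hπ : 0 < π₁ ∧ π₁ < 1) (hα : 0 < α ∧ α < 1)
    {T : Sample D n → ℝ} (hT : Measurable T) :
    (fun z => if permQuantile α T z < T z then (1 : Fin 2) else 0) ∈ levelTests D n π₁ α := by
  refine ⟨Measurable.ite (measurableSet_lt (measurable_permQuantile hα hT) hT) measurable_const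
    measurable_const, le_of_eq_of_le (congrArg _ ?_) (worstProb_nullClass_le hπ hα hT)⟩
  ext z
  simp

theorem minSeparation_le_of_permTest (hπ : 0 < π₁ ∧ π₁ < 1) (hα : 0 < α ∧ α < 1)
    {T : Sample D n → ℝ} (hT : Measurable T) {δ : ℝ} (hδ : 0 ≤ δ)
    (h : worstProb π₁ (lipAlternatives D π₁ L x τ ε₀ δ) {z | T z ≤ permQuantile α T z}
      ≤ ENNReal.ofReal β) :
    minSeparation D n π₁ L x τ ε₀ α β ≤ ENNReal.ofReal δ := by
  refine sInf_le ⟨δ, ⟨hδ, (iInf₂_le _ (permTest_mem_levelTests hπ hα hT)).trans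
    (le_of_eq_of_le (congrArg _ ?_) h)⟩, rfl⟩
  ext z
  simp

/-- The minimum separation never exceeds `2`: as `m` and `π₁` are in `[0, 1]`, no alternative is
further apart. -/
theorem minSeparation_le_two (hπ : 0 < π₁ ∧ π₁ < 1) (hα : 0 < α ∧ α < 1) :
    minSeparation D n π₁ L x τ ε₀ α β ≤ ENNReal.ofReal 2 := by
  refine minSeparation_le_of_permTest hπ hα (T := fun _ => 0) measurable_const zero_le_two ?_
  refine iSup₂_le fun M hM => ?_
  have h1 := M.reg_mem_Icc hπ x
  have h2 : 2 ≤ (M.reg π₁ x - π₁) ^ 2 := hM.2.2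
  nlinarith [h1.1, h1.2, hπ.1, hπ.2]

end Separation

theorem corollary2 (D : ℕ) (hD : 0 < D) (π₁ : ℝ) (hπ : 0 < π₁ ∧ π₁ < 1)
    (L : ℝ) (hL : 0 < L) (x : Feat D) (τ ε₀ : ℝ) (hτ : 0 < τ) (hε₀ : 0 < ε₀)
    (α β : ℝ) (hα : 0 < α ∧ α < 1) (hβ : 0 < β ∧ β < 1 - α) :
    -- kNN test; `k` is the real number `n^(2/(2+D))` rounded down or up
    (∃ C : ℝ, ∃ N : ℕ, 0 < C ∧ 0 < N ∧
      ∀ n k : ℕ, 1 ≤ n → |(k : ℝ) - (n : ℝ) ^ (2 / (2 + (D : ℝ)))| < 1 →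
        worstProb π₁ (nullClass D π₁)
            {z : Sample D n | knnStat k x z > permQuantile α (knnStat k x) z}
          ≤ ENNReal.ofReal α ∧
        (N ≤ n →
          worstProb π₁ (lipAlternatives D π₁ L x τ ε₀ (C * (n : ℝ) ^ (-(2 / (2 + (D : ℝ))))))
              {z : Sample D n | knnStat k x z ≤ permQuantile α (knnStat k x) z}
            ≤ ENNReal.ofReal β)) ∧
    -- kernel test with bandwidth `h = n^(-1/(2+D))`
    (∀ lam r R : ℝ, 0 < lam → lam < 1 → 0 < r → r < R →
      ∃ C : ℝ, ∃ N : ℕ, 0 < C ∧ 0 < N ∧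
      ∀ K ∈ kernelClass D lam r R, ∀ n : ℕ, ∀ h : ℝ, 1 ≤ n →
        h = (n : ℝ) ^ (-(1 / (2 + (D : ℝ)))) →
        worstProb π₁ (nullClass D π₁)
            {z : Sample D n | kernelStat K h x z > permQuantile α (kernelStat K h x) z}
          ≤ ENNReal.ofReal α ∧
        (N ≤ n →
          worstProb π₁ (lipAlternatives D π₁ L x τ ε₀ (C * (n : ℝ) ^ (-(2 / (2 + (D : ℝ))))))
              {z : Sample D n | kernelStat K h x z ≤ permQuantile α (kernelStat K h x) z}
            ≤ ENNReal.ofReal β)) ∧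
    -- minimum separation
    (∃ C : ℝ, 0 < C ∧ ∀ n : ℕ, 1 ≤ n →
      minSeparation D n π₁ L x τ ε₀ α β
        ≤ ENNReal.ofReal (C * (n : ℝ) ^ (-(2 / (2 + (D : ℝ)))))) := by
  have hknn : ∀ n k, Measurable (knnStat k x : Sample D n → ℝ) := fun n k => by
    rw [knnStat_eq_linearStat]
    exact measurable_linearStat (measurable_knnWeight k x)
  obtain ⟨C, N, hC, hN, hpow⟩ := exists_knn_power D hD x hπ hL hτ hε₀ hα hβ.1
  refine ⟨⟨C, N, hC, hN, fun n k _ hk =>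
    ⟨worstProb_nullClass_le hπ hα (hknn n k), fun hn => hpow n k hn hk⟩⟩, ?_, ?_⟩
  · intro lam r R hlam _ hr hrR
    obtain ⟨C, N, hC, hN, hpow⟩ := exists_kernel_power D x hπ hL hτ hε₀ hα hβ.1 hlam hr hrR
    refine ⟨C, N, hC, hN, fun K hK n h _ hh => ⟨worstProb_nullClass_le hπ hα ?_, fun hn => ?_⟩⟩
    · rw [kernelStat_eq_linearStat]
      exact measurable_linearStat (measurable_kernelWeight hK h x)
    · subst hh
      exact hpow K hK n hn
  · -- Below `N` the bound `2` is a multiple of the rate.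
    refine ⟨max C (2 * (bandwidth D N ^ 2)⁻¹), lt_max_of_lt_left hC, fun n hn => ?_⟩
    have hrate : 0 < (n : ℝ) ^ (-(2 / (2 + (D : ℝ)))) :=
      Real.rpow_pos_of_pos (Nat.cast_pos.2 hn) _
    rcases le_total N n with hNn | hnN
    · have hk : |((⌊(n : ℝ) ^ (2 / (2 + (D : ℝ)))⌋₊ : ℕ) : ℝ) - (n : ℝ) ^ (2 / (2 + (D : ℝ)))|
          < 1 := by
        have h1 := Nat.floor_le (Real.rpow_nonneg (Nat.cast_nonneg n) (2 / (2 + (D : ℝ))))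
        have h2 := Nat.lt_floor_add_one ((n : ℝ) ^ (2 / (2 + (D : ℝ))))
        rw [abs_lt]
        constructor <;> linarith
      refine (minSeparation_le_of_permTest hπ hα (hknn n _) (mul_pos hC hrate).le
        (hpow n _ hNn hk)).trans (ENNReal.ofReal_le_ofReal ?_)
      exact mul_le_mul_of_nonneg_right (le_max_left _ _) hrate.le
    · refine (minSeparation_le_two hπ hα).trans (ENNReal.ofReal_le_ofReal ?_)
      refine le_trans ?_ (mul_le_mul_of_nonneg_right (le_max_right _ _) hrate.le)
      have hle : bandwidth D N ^ 2 ≤ (n : ℝ) ^ (-(2 / (2 + (D : ℝ)))) := by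
        rw [bandwidth_sq]
        exact Real.rpow_le_rpow_of_nonpos (Nat.cast_pos.2 hn) (Nat.cast_le.2 hnN)
          (neg_nonpos.2 (by positivity))
      have hb := bandwidth_pos (D := D) hN
      have h1 := (le_inv_mul_iff₀ (pow_pos hb 2)).2 ((mul_one _).trans_le hle)
      rw [mul_assoc]
      linarith
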